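/- Let $(M,\pi)$ be a Poisson manifold: $M$ is a smooth finite-dimensional manifold without boundary (Hausdorff, second countable, not necessarily connected), and $\pi$ is a smooth bivector field, with induced bundle map $\pi^\sharp\colon T^*M\to TM$, $\pi^\sharp\alpha=\pi(\alpha,\cdot)$, whose bracket $\{f,g\}=\pi(df,dg)$ on $C^\infty(M)$ satisfies the Jacobi identity. Let $\mathcal F=\pi^\sharp(\Gamma_c(T^*M))$ be the $C^\infty(M)$-module of vector fields that are images under $\pi^\sharp$ of compactly supported smooth one-forms. Its leaves are the symplectic leaves of $(M,\pi)$; the tangent space at $x$ of the symplectic leaf $L$ through $x$ is $T_xL=\{X(x): X\in\mathcal F\}$. Call $(M,\pi)$ almost regular if there are a smooth vector bundle $A\to M$ (of constant finite rank) and an isomorphism of $C^\infty(M)$-modules $\mathcal F\cong\Gamma_c(A)$, where $\Gamma_c(A)$ is the module of compactly supported smooth sections of $A$. Let $M_{\mathrm{reg}}$ be the set of points of $M$ at which the rank of $\pi$ is maximal, that is, at least the rank of $\pi$ at every other point of $M$. A distribution on $M$ is a smooth vector subbundle of $TM$ of constant rank. Then $(M,\pi)$ is almost regular if and only if both of the following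 conditions hold: (i) $M_{\mathrm{reg}}$ is dense in $M$; (ii) there is a distribution $D$ on $M$ such that $D_x=T_xL$ for every $x\in M_{\mathrm{reg}}$, where $L$ is the symplectic leaf through $x$. Moreover, if $(M,\pi)$ is almost regular, then the distribution $D$ in (ii) is unique and involutive, $\pi^\sharp(T_x^*M)\subseteq D_x$ for every $x\in M$, and the leaves of $D$ are Poisson submanifolds. More precisely, every injectively immersed integral manifold $\iota\colon N\to M$ of $D$ (in particular every leaf of $D$, that is, every maximal connected one) carries a Poisson structure $\pi_N$ such that $d\iota_y\circ\pi_{N,y}^\sharp\circ(d\iota_y)^*=\pi^\sharp_{\iota(y)}$ for all $y\in N$. -/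

import Mathlib

open Set Bundle Module
open scoped Manifold ContDiff

universe u v w

noncomputable section

namespace AlmostRegularPoisson

/-! ### Smooth sections as a module over the smooth functions -/

section Sections

variable {E : Type u} [NormedAddCommGroup E] [NormedSpace ℝ E]
  {M : Type v} [TopologicalSpace M] [ChartedSpace E M]
  {F : Type*} [NormedAddCommGroup F] [NormedSpace ℝ F]
  {V : M → Type*} [TopologicalSpace (TotalSpace F V)]
  [∀ x, TopologicalSpace (V x)] [FiberBundle F V]
  [∀ x, AddCommGroup (V x)] [∀ x, Module ℝ (V x)] [VectorBundle ℝ F V]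

instance instSMulSection : SMul C^∞⟮𝓘(ℝ, E), M; ℝ⟯ Cₛ^∞⟮𝓘(ℝ, E); F, V⟯ :=
  ⟨fun f s => ⟨fun x => f x • s x, f.contMDiff.smul_section s.contMDiff⟩⟩

@[simp]
theorem smul_section_apply (f : C^∞⟮𝓘(ℝ, E), M; ℝ⟯) (s : Cₛ^∞⟮𝓘(ℝ, E); F, V⟯) (x : M) :
    (f • s) x = f x • s x := rfl

/-- `Γ(V)` is a `C^∞(M)`-module under pointwise multiplication. -/
instance instModuleSection : Module C^∞⟮𝓘(ℝ, E), M; ℝ⟯ Cₛ^∞⟮𝓘(ℝ, E); F, V⟯ where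
  one_smul s := ContMDiffSection.ext fun x => one_smul ℝ (s x)
  mul_smul f g s := ContMDiffSection.ext fun x => mul_smul (f x) (g x) (s x)
  smul_zero f := ContMDiffSection.ext fun x => smul_zero (f x)
  smul_add f s t := ContMDiffSection.ext fun x => smul_add (f x) (s x) (t x)
  add_smul f g s := ContMDiffSection.ext fun x => add_smul (f x) (g x) (s x)
  zero_smul s := ContMDiffSection.ext fun x => zero_smul ℝ (s x)

/-- A section has compact support if the closure of `{x | s x ≠ 0}` is compact. -/
def IsCompactlySupported (s : ∀ x, V x) : Prop := IsCompact (closure {x | s x ≠ 0})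

variable (E F V) in
/-- `Γ_c(V)`, the `C^∞(M)`-module of compactly supported smooth sections. -/
def compactSections : Submodule C^∞⟮𝓘(ℝ, E), M; ℝ⟯ Cₛ^∞⟮𝓘(ℝ, E); F, V⟯ where
  carrier := {s | IsCompactlySupported (s : ∀ x, V x)}
  zero_mem' := by simp [IsCompactlySupported]
  add_mem' := by
    intro s t hs ht
    refine (hs.union ht).of_isClosed_subset isClosed_closure ?_
    rw [← closure_union]
    refine closure_mono fun x hx => ?_
    by_contra h
    simp only [mem_union, mem_ofPred_eq, not_or, not_not] at h
    exact hx (by simp [h.1, h.2])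
  smul_mem' := by
    intro f s hs
    refine hs.of_isClosed_subset isClosed_closure (closure_mono fun x hx h => hx ?_)
    simp [h]

end Sections

section Manifolds

variable (E : Type u) [NormedAddCommGroup E] [NormedSpace ℝ E]
  (M : Type v) [TopologicalSpace M] [ChartedSpace E M]

/-- The tangent space of `M` at `x`, where `M` is a boundaryless manifold modelled on `E`. -/
abbrev TSpace (x : M) : Type u := TangentSpace 𝓘(ℝ, E) x

/-- The cotangent space of `M` at `x`. -/
abbrev CoTSpace (x : M) : Type u := TSpace E M x →L[ℝ] Bundle.Trivial M ℝ x

variable [IsManifold 𝓘(ℝ, E) ∞ M]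

/-- The `C^∞(M)`-module of smooth vector fields. -/
abbrev VecField : Type (max u v) := Cₛ^∞⟮𝓘(ℝ, E); E, (TSpace E M)⟯

/-- The `C^∞(M)`-module of smooth one-forms. -/
abbrev OneForm : Type (max u v) := Cₛ^∞⟮𝓘(ℝ, E); E →L[ℝ] ℝ, (CoTSpace E M)⟯

end Manifolds

section Poisson

variable {E : Type u} [NormedAddCommGroup E] [NormedSpace ℝ E]
  {M : Type v} [TopologicalSpace M] [ChartedSpace E M]

/-- The differential of a function at a point, as a covector. -/
def differential (f : M → ℝ) (x : M) : CoTSpace E M x := mfderiv 𝓘(ℝ, E) 𝓘(ℝ, ℝ) f x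

/-- The bracket `{f, g} = π(df, dg) = dg(π^♯ df)` of a bivector field given by its sharp map. -/
def bracket (sharp : ∀ x : M, CoTSpace E M x →L[ℝ] TSpace E M x) (f g : M → ℝ) : M → ℝ :=
  fun x => (differential g x : TSpace E M x →L[ℝ] ℝ) (sharp x (differential f x))

variable [IsManifold 𝓘(ℝ, E) ∞ M]

variable (E M) in
/-- A Poisson structure on `M`: a smooth bivector field `π`, encoded by the smooth bundle map
`π^♯ : T^*M → TM`, `π^♯ α = π(α, ·)`, such that the bracket `{f, g} = π(df, dg)` satisfies the
Jacobi identity on `C^∞(M)`, i.e. `[π, π] = 0`. -/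
structure PoissonStructure where
  sharp : ∀ x : M, CoTSpace E M x →L[ℝ] TSpace E M x
  smooth : ContMDiff 𝓘(ℝ, E) (𝓘(ℝ, E).prod 𝓘(ℝ, (E →L[ℝ] ℝ) →L[ℝ] E)) ∞
    (fun x => TotalSpace.mk' ((E →L[ℝ] ℝ) →L[ℝ] E)
      (E := fun x : M => CoTSpace E M x →L[ℝ] TSpace E M x) x (sharp x))
  skew : ∀ (x : M) (α β : CoTSpace E M x), β (sharp x α) = -α (sharp x β)
  jacobi : ∀ (f g h : C^∞⟮𝓘(ℝ, E), M; ℝ⟯) (x : M),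
    bracket sharp f (bracket sharp g h) x + bracket sharp g (bracket sharp h f) x
      + bracket sharp h (bracket sharp f g) x = 0

namespace PoissonStructure

variable (P : PoissonStructure E M)

/-- The singular foliation `𝓕 = π^♯(Γ_c(T^*M))`, as a `C^∞(M)`-module of vector fields. -/
def foliation : Submodule C^∞⟮𝓘(ℝ, E), M; ℝ⟯ (VecField E M) where
  carrier := {X | ∃ α ∈ compactSections E (E →L[ℝ] ℝ) (CoTSpace E M),
    ∀ x, X x = P.sharp x (α x)}
  zero_mem' := ⟨0, zero_mem _, fun x => by simp⟩
  add_mem' := by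
    rintro X Y ⟨α, hα, hX⟩ ⟨β, hβ, hY⟩
    exact ⟨α + β, add_mem hα hβ, fun x => by simp [hX, hY]⟩
  smul_mem' := by
    rintro f X ⟨α, hα, hX⟩
    exact ⟨f • α, Submodule.smul_mem _ f hα, fun x => by simp [hX]⟩

/-- `(M, π)` is almost regular if `𝓕` is projective: `𝓕 ≅ Γ_c(A)` as `C^∞(M)`-modules for some smooth
real vector bundle `A → M` of finite (constant) rank `r`. -/
def AlmostRegular : Prop :=
  ∃ (r : ℕ) (A : M → Type) (_ : TopologicalSpace (TotalSpace (Fin r → ℝ) A))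
    (_ : ∀ x, TopologicalSpace (A x)) (_ : ∀ x, AddCommGroup (A x)) (_ : ∀ x, Module ℝ (A x))
    (_ : FiberBundle (Fin r → ℝ) A) (_ : VectorBundle ℝ (Fin r → ℝ) A)
    (_ : ContMDiffVectorBundle ∞ (Fin r → ℝ) A 𝓘(ℝ, E)),
    Nonempty (P.foliation ≃ₗ[C^∞⟮𝓘(ℝ, E), M; ℝ⟯] compactSections E (Fin r → ℝ) A)

/-- The rank of `π` at `x`. -/
def rank (x : M) : ℕ := finrank ℝ (LinearMap.range (P.sharp x : CoTSpace E M x →ₗ[ℝ] TSpace E M x))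

/-- `M_reg`, the set of points where `π` has maximal rank. -/
def regularSet : Set M := {x | ∀ y, P.rank y ≤ P.rank x}

/-- The tangent space `T_x L` at `x` of the symplectic leaf `L` through `x`. The symplectic leaves
are the leaves of the singular foliation `𝓕`, and their tangent spaces consist of the values of
the vector fields in `𝓕`. -/
def leafTangent (x : M) : Submodule ℝ (TSpace E M x) where
  carrier := {v | ∃ X ∈ P.foliation, X x = v}
  zero_mem' := ⟨0, zero_mem _, rfl⟩
  add_mem' := by
    rintro _ _ ⟨X, hX, rfl⟩ ⟨Y, hY, rfl⟩
    exact ⟨X + Y, add_mem hX hY, rfl⟩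
  smul_mem' := by
    rintro c _ ⟨X, hX, rfl⟩
    exact ⟨(ContMDiffMap.const c : C^∞⟮𝓘(ℝ, E), M; ℝ⟯) • X, Submodule.smul_mem _ _ hX, rfl⟩

end PoissonStructure

/-- A (constant rank, smooth) distribution on `M`: a family of subspaces of the tangent spaces, all
of the same dimension `k`, locally spanned by `k` smooth vector fields. -/
def IsDistribution (D : ∀ x : M, Submodule ℝ (TSpace E M x)) : Prop :=
  ∃ k : ℕ, (∀ x, finrank ℝ (D x) = k) ∧
    ∀ x₀ : M, ∃ (U : Set M) (X : Fin k → ∀ x : M, TSpace E M x), IsOpen U ∧ x₀ ∈ U ∧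
      (∀ i, ContMDiffOn 𝓘(ℝ, E) 𝓘(ℝ, E).tangent ∞
        (fun x => (TotalSpace.mk' E x (X i x) : TangentBundle 𝓘(ℝ, E) M)) U) ∧
      ∀ x ∈ U, D x = Submodule.span ℝ (Set.range fun i => X i x)

/-- `D` is involutive: the smooth vector fields tangent to `D` are closed under the Lie bracket. -/
def IsInvolutive (D : ∀ x : M, Submodule ℝ (TSpace E M x)) : Prop :=
  ∀ X Y : VecField E M, (∀ x, X x ∈ D x) → (∀ x, Y x ∈ D x) →
    ∀ x, VectorField.mlieBracket 𝓘(ℝ, E) (fun y => X y) (fun y => Y y) x ∈ D x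

section Submanifolds

variable {G : Type*} [NormedAddCommGroup G] [NormedSpace ℝ G]
  {N : Type w} [TopologicalSpace N] [ChartedSpace G N]

/-- The injectively immersed manifold `ι : N → M` is an integral manifold of the distribution `D`:
the tangent spaces of `N` are given by `D`. The leaves of `D` are the maximal connected integral
manifolds. -/
structure IsIntegralManifold (D : ∀ x : M, Submodule ℝ (TSpace E M x)) (ι : N → M) : Prop where
  injective : Function.Injective ι
  isImmersion : Manifold.IsImmersion 𝓘(ℝ, G) 𝓘(ℝ, E) ∞ ι
  range_mfderiv : ∀ y, LinearMap.range
    (mfderiv 𝓘(ℝ, G) 𝓘(ℝ, E) ι y : TSpace G N y →ₗ[ℝ] TSpace E M (ι y)) = D (ι y)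

variable [IsManifold 𝓘(ℝ, G) ∞ N]

/-- The injectively immersed manifold `ι : N → M` is a Poisson submanifold of `(M, π)`: it carries
a Poisson structure `π_N` for which `ι` is a Poisson map, `dι ∘ π_N^♯ ∘ (dι)^* = π^♯`. -/
def IsPoissonSubmanifold (P : PoissonStructure E M) (ι : N → M) : Prop :=
  Function.Injective ι ∧ Manifold.IsImmersion 𝓘(ℝ, G) 𝓘(ℝ, E) ∞ ι ∧
    ∃ Q : PoissonStructure G N, ∀ (y : N) (α : CoTSpace E M (ι y)),
      mfderiv 𝓘(ℝ, G) 𝓘(ℝ, E) ι y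
        (Q.sharp y (ContinuousLinearMap.comp (show TSpace E M (ι y) →L[ℝ] ℝ from α)
          (mfderiv 𝓘(ℝ, G) 𝓘(ℝ, E) ι y : TSpace G N y →L[ℝ] TSpace E M (ι y)))) =
      P.sharp (ι y) α

end Submanifolds

end Poisson

end AlmostRegularPoisson

end

open AlmostRegularPoisson

/-! Suppose `𝓕 ≅ Γ_c(A)`. The map `Γ_c(T^*M) → 𝓕 ≅ Γ_c(A)` and the inclusion of `𝓕` in the vector
fields are `C^∞(M)`-linear, hence given fibrewise: `π^♯` factors at each point as a surjection
`T_x^*M → A_x` (`fiberLift`) followed by an anchor `A_x → T_xM`. So the rank of `π` never exceeds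
the rank of `A`. Where the rank is locally maximal, any covector in `ker π^♯` extends to a local
one-form in `ker π^♯`, which maps to zero in `Γ_c(A)`; the two kernels then agree and the rank
equals that of `A` (`rank_eq_of_locally_maximal`). Every nonempty open set contains such a point, so
`M_reg` is dense. The distribution is the annihilator of `ker (T^*M → A)`, the image of the dual map
`A^* → TM` (`dualImage`). It has the rank of `A` and contains the image of `π^♯` by skew-symmetry,
so the two coincide on `M_reg`.

Conversely, let `D` be a distribution extending the leaf tangents from a dense `M_reg`. Restriction
of one-forms gives a surjection `Γ_c(T^*M) → Γ_c(D^*)` by a partition of unity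
(`restrictCompact_surjective`), and its kernel is that of `π^♯` by continuity and skew-symmetry
(`ker_sharpCompact_eq`). Hence `𝓕 ≅ Γ_c(D^*)`.

The remaining claims rest on one closedness fact: a smooth field tangent to `D` on a dense set is
tangent to `D` everywhere (`IsDistribution.mem_of_dense`). It gives uniqueness, `im π^♯ ⊆ D`, and
involutivity, since on `M_reg` brackets of fields in the image of `π^♯` stay in that image. For an
integral manifold `N`, `im π^♯ ⊆ TN` lets `π` descend to `N`; brackets on `N` are computed from
local extensions to `M`, which yields smoothness and the Jacobi identity. -/

noncomputable section

namespace AlmostRegularPoisson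

open Filter Topology

/-! ### Cutoffs, local frames, and tensoriality of `C^∞(M)`-linear maps. -/

section Generic

variable {E : Type u} [NormedAddCommGroup E] [NormedSpace ℝ E] [FiniteDimensional ℝ E]
  {M : Type v} [TopologicalSpace M] [ChartedSpace E M] [IsManifold 𝓘(ℝ, E) ∞ M] [T2Space M]

theorem exists_bump (x : M) {U : Set M} (hU : U ∈ 𝓝 x) :
    ∃ χ : C^∞⟮𝓘(ℝ, E), M; ℝ⟯, (∀ᶠ y in 𝓝 x, χ y = 1) ∧ tsupport χ ⊆ U ∧ HasCompactSupport χ := by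
  obtain ⟨f, -, hf⟩ := (SmoothBumpFunction.nhds_basis_tsupport (I := 𝓘(ℝ, E)) x).mem_iff.1 hU
  exact ⟨⟨f, f.contMDiff⟩, f.eventuallyEq_one, hf, f.hasCompactSupport⟩

theorem exists_contMDiffMap_eventuallyEq {x : M} {U : Set M} (hU : IsOpen U) (hx : x ∈ U)
    {f : M → ℝ} (hf : ContMDiffOn 𝓘(ℝ, E) 𝓘(ℝ, ℝ) ∞ f U) :
    ∃ g : C^∞⟮𝓘(ℝ, E), M; ℝ⟯, ∀ᶠ y in 𝓝 x, g y = f y := by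
  obtain ⟨χ, h1, hs, -⟩ := exists_bump (E := E) x (hU.mem_nhds hx)
  have h : ContMDiff 𝓘(ℝ, E) 𝓘(ℝ, ℝ) ∞ fun y => χ y * f y := ?_
  · exact ⟨⟨_, h⟩, h1.mono fun y hy => show χ y * f y = f y by rw [hy, one_mul]⟩
  refine contMDiff_of_tsupport fun y hy => ?_
  have hyU : y ∈ U := hs (closure_mono (fun z hz => left_ne_zero_of_mul hz) hy)
  exact χ.contMDiff.contMDiffAt.mul (hf.contMDiffAt (hU.mem_nhds hyU))

section Bundle

variable {F : Type*} [NormedAddCommGroup F] [NormedSpace ℝ F]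
  {V : M → Type*} [TopologicalSpace (TotalSpace F V)]
  [∀ x, TopologicalSpace (V x)] [FiberBundle F V]
  [∀ x, AddCommGroup (V x)] [∀ x, Module ℝ (V x)] [VectorBundle ℝ F V]

omit [FiniteDimensional ℝ E] [IsManifold 𝓘(ℝ, E) ∞ M] [T2Space M] in
theorem section_smul_mem_compactSections {χ : C^∞⟮𝓘(ℝ, E), M; ℝ⟯} (hχ : HasCompactSupport χ)
    (s : Cₛ^∞⟮𝓘(ℝ, E); F, V⟯) : χ • s ∈ compactSections E F V := by
  refine hχ.of_isClosed_subset isClosed_closure (closure_mono fun y hy h => hy ?_)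
  simp [h]

omit [FiniteDimensional ℝ E] [IsManifold 𝓘(ℝ, E) ∞ M] [T2Space M] in
@[simp]
theorem section_sum_apply {ι : Type*} (t : Finset ι) (s : ι → Cₛ^∞⟮𝓘(ℝ, E); F, V⟯) (x : M) :
    (∑ i ∈ t, s i) x = ∑ i ∈ t, s i x := by
  classical
  induction t using Finset.induction_on with
  | empty => simp
  | insert a t ha ih => simp [Finset.sum_insert ha, ih]

/-- A section that is smooth on an open set can be cut off to a global one. -/
theorem exists_section_eventuallyEq {x : M} {U : Set M} (hU : IsOpen U) (hx : x ∈ U)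
    {s : ∀ y, V y} (hs : ContMDiffOn 𝓘(ℝ, E) (𝓘(ℝ, E).prod 𝓘(ℝ, F)) ∞
      (fun y => TotalSpace.mk' F y (s y)) U) :
    ∃ (χ : C^∞⟮𝓘(ℝ, E), M; ℝ⟯) (t : Cₛ^∞⟮𝓘(ℝ, E); F, V⟯), t ∈ compactSections E F V ∧
      (∀ y, t y = χ y • s y) ∧ (∀ y ∉ U, χ y = 0) ∧ ∀ᶠ y in 𝓝 x, χ y = 1 := by
  obtain ⟨χ, h1, hsupp, hc⟩ := exists_bump (E := E) x (hU.mem_nhds hx)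
  refine ⟨χ, ⟨_, ContMDiffOn.smul_section_of_tsupport χ.contMDiff.contMDiffOn hU hsupp hs⟩,
    ?_, fun y => rfl, fun y hy => ?_, h1⟩
  · refine hc.of_isClosed_subset isClosed_closure (closure_mono fun y hy h => hy ?_)
    change χ y • s y = 0
    simp [h]
  · exact image_eq_zero_of_notMem_tsupport fun h => hy (hsupp h)

variable [FiniteDimensional ℝ F] [ContMDiffVectorBundle ∞ F V 𝓘(ℝ, E)]

variable (F V) in
/-- Local frames consisting of global compactly supported sections, with their coefficients. -/
theorem exists_frame (x : M) : ∃ (U : Set M) (e : Fin (finrank ℝ F) → Cₛ^∞⟮𝓘(ℝ, E); F, V⟯)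
    (c : Fin (finrank ℝ F) → ∀ y, V y →ₗ[ℝ] ℝ), IsOpen U ∧ x ∈ U ∧
      (∀ i, e i ∈ compactSections E F V) ∧ (∀ y ∈ U, ∀ v : V y, v = ∑ i, c i y v • e i y) ∧
      (∀ y ∈ U, ∀ i j, c i y (e j y) = if i = j then 1 else 0) ∧
      ∀ s : Cₛ^∞⟮𝓘(ℝ, E); F, V⟯, ∀ i,
        ContMDiffOn 𝓘(ℝ, E) 𝓘(ℝ, ℝ) ∞ (fun y => c i y (s y)) U := by
  have : ContMDiffVectorBundle 1 F V 𝓘(ℝ, E) := ContMDiffVectorBundle.of_le (n := ∞) (by simp)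
  let b := finBasis ℝ F
  let e := trivializationAt F V x
  have hxe : x ∈ e.baseSet := FiberBundle.mem_baseSet_trivializationAt F V x
  obtain ⟨χ, h1, hsupp, hc⟩ := exists_bump (E := E) x (e.open_baseSet.mem_nhds hxe)
  obtain ⟨W, hW, hWo, hxW⟩ := mem_nhds_iff.1 h1
  have hWe : W ⊆ e.baseSet := fun y hy =>
    hsupp (subset_closure (by simpa using (show χ y ≠ 0 by rw [hW hy]; exact one_ne_zero)))
  let s : Fin (finrank ℝ F) → Cₛ^∞⟮𝓘(ℝ, E); F, V⟯ := fun i =>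
    ⟨_, ContMDiffOn.smul_section_of_tsupport χ.contMDiff.contMDiffOn e.open_baseSet hsupp
      (e.contMDiffOn_localFrame_baseSet (I := 𝓘(ℝ, E)) ∞ b i)⟩
  have hs : ∀ i, ∀ y ∈ W, s i y = e.localFrame b i y := by
    intro i y hy
    change χ y • e.localFrame b i y = _
    rw [hW hy, one_smul]
  refine ⟨W, s, fun i y => e.localFrameCoeff 𝓘(ℝ, E) b i y, hWo, hxW, fun i => ?_,
    fun y hy v => ?_, fun y hy i j => ?_, fun t i => ?_⟩
  · refine hc.of_isClosed_subset isClosed_closure (closure_mono fun y hy h => hy ?_)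
    change χ y • e.localFrame b i y = 0
    simp [h]
  · simp_rw [hs _ y hy]
    classical
    have := Bundle.Trivialization.eq_sum_localFrameCoeff_smul (I := 𝓘(ℝ, E)) (e := e) (b := b)
      (s := Function.update 0 y v) (hWe hy)
    simpa using this
  · rw [hs _ y hy, e.localFrameCoeff_apply_of_mem_baseSet b (hWe hy),
      e.localFrame_apply_of_mem_baseSet b (hWe hy), Basis.repr_self, Finsupp.single_apply]
    simp [eq_comm]
  · exact contMDiffOn_localFrameCoeff b hWo hWe t.contMDiff.contMDiffOn i

theorem exists_compactSection_apply_eq (x : M) (v : V x) :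
    ∃ s : compactSections E F V, (s : Cₛ^∞⟮𝓘(ℝ, E); F, V⟯) x = v := by
  obtain ⟨U, e, c, -, hx, he, hv, -⟩ := exists_frame (E := E) F V x
  refine ⟨∑ i, (ContMDiffMap.const (c i x v) : C^∞⟮𝓘(ℝ, E), M; ℝ⟯) •
    (⟨e i, he i⟩ : compactSections E F V), ?_⟩
  rw [AddSubmonoidClass.coe_finsetSum, section_sum_apply]
  exact (hv x hx v).symm

variable {F' : Type*} [NormedAddCommGroup F'] [NormedSpace ℝ F']
  {V' : M → Type*} [TopologicalSpace (TotalSpace F' V')]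
  [∀ x, TopologicalSpace (V' x)] [FiberBundle F' V']
  [∀ x, AddCommGroup (V' x)] [∀ x, Module ℝ (V' x)] [VectorBundle ℝ F' V']

/-- Tensoriality: this is what makes `fiberMap` independent of the section chosen through a vector.
-/
theorem linearMap_apply_eq_zero
    (L : compactSections E F V →ₗ[C^∞⟮𝓘(ℝ, E), M; ℝ⟯] Cₛ^∞⟮𝓘(ℝ, E); F', V'⟯)
    {s : compactSections E F V} {x : M} (hs : (s : Cₛ^∞⟮𝓘(ℝ, E); F, V⟯) x = 0) : L s x = 0 := by
  obtain ⟨U, e, c, hU, hx, he, hv, -, hc⟩ := exists_frame (E := E) F V x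
  choose f hf using fun i => exists_contMDiffMap_eventuallyEq hU hx (hc s i)
  have hev : ∀ᶠ y in 𝓝 x, (s : Cₛ^∞⟮𝓘(ℝ, E); F, V⟯) y = ∑ i, f i y • e i y := by
    filter_upwards [eventually_all.2 hf, hU.mem_nhds hx] with y hy hyU
    simp_rw [hy]
    exact hv y hyU _
  obtain ⟨χ, h1, hsupp, -⟩ := exists_bump (E := E) x hev
  -- The frame expansion holds only near `x`; the term `(1 - χ) • s` absorbs the rest, and all
  -- coefficients in this global identity vanish at `x`.
  have key : s = ∑ i, (χ * f i) • (⟨e i, he i⟩ : compactSections E F V) + (1 - χ) • s := by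
    refine Subtype.ext (ContMDiffSection.ext fun y => ?_)
    rw [Submodule.coe_add, AddSubmonoidClass.coe_finsetSum, ContMDiffSection.coe_add, Pi.add_apply,
      section_sum_apply]
    change _ = ∑ i, (χ y * f i y) • e i y + (1 - χ y) • (s : Cₛ^∞⟮𝓘(ℝ, E); F, V⟯) y
    by_cases hy : y ∈ tsupport χ
    · have := hsupp hy
      simp only [mem_ofPred_eq] at this
      simp_rw [mul_smul, ← Finset.smul_sum, ← this, ← add_smul]
      simp
    · simp [image_eq_zero_of_notMem_tsupport hy]
  rw [key, map_add, map_sum, ContMDiffSection.coe_add, Pi.add_apply, section_sum_apply]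
  simp only [map_smul]
  have hfx : ∀ i, (χ * f i) x = 0 := by
    intro i
    change χ x * f i x = 0
    rw [(hf i).self_of_nhds, hs, map_zero, mul_zero]
  have h0 : (1 - χ) x = 0 := by
    change 1 - χ x = 0
    rw [h1.self_of_nhds, sub_self]
  simp [hfx, h0]

/-- The fibrewise linear map induced by a `C^∞(M)`-linear map of sections. -/
def fiberMap (L : compactSections E F V →ₗ[C^∞⟮𝓘(ℝ, E), M; ℝ⟯] Cₛ^∞⟮𝓘(ℝ, E); F', V'⟯) (x : M) :
    V x →ₗ[ℝ] V' x :=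
  have key (s t : compactSections E F V)
      (h : (s : Cₛ^∞⟮𝓘(ℝ, E); F, V⟯) x = (t : Cₛ^∞⟮𝓘(ℝ, E); F, V⟯) x) : L s x = L t x := by
    have := linearMap_apply_eq_zero L (s := s - t) (x := x) (by simp [h])
    rwa [map_sub, ContMDiffSection.coe_sub, Pi.sub_apply, sub_eq_zero] at this
  have hch (v : V x) := (exists_compactSection_apply_eq (E := E) (F := F) x v).choose_spec
  { toFun := fun v => L (exists_compactSection_apply_eq (E := E) (F := F) x v).choose x
    map_add' := fun v w => by
      rw [← Pi.add_apply, ← ContMDiffSection.coe_add, ← map_add]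
      exact key _ _ (by simp [hch])
    map_smul' := fun a v => by
      have : L ((ContMDiffMap.const a : C^∞⟮𝓘(ℝ, E), M; ℝ⟯) •
        (exists_compactSection_apply_eq (E := E) (F := F) x v).choose) x =
        a • L (exists_compactSection_apply_eq (E := E) (F := F) x v).choose x := by
        rw [map_smul]; rfl
      rw [RingHom.id_apply, ← this]
      refine key _ _ ?_
      rw [hch]
      change _ = a • ((exists_compactSection_apply_eq (E := E) (F := F) x v).choose :
        Cₛ^∞⟮𝓘(ℝ, E); F, V⟯) x
      rw [hch] }

theorem fiberMap_apply
    (L : compactSections E F V →ₗ[C^∞⟮𝓘(ℝ, E), M; ℝ⟯] Cₛ^∞⟮𝓘(ℝ, E); F', V'⟯)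
    (s : compactSections E F V) (x : M) :
    fiberMap L x ((s : Cₛ^∞⟮𝓘(ℝ, E); F, V⟯) x) = L s x := by
  have h := (exists_compactSection_apply_eq (E := E) (F := F) x
    ((s : Cₛ^∞⟮𝓘(ℝ, E); F, V⟯) x)).choose_spec
  have := linearMap_apply_eq_zero L (x := x) (s := (exists_compactSection_apply_eq (E := E) (F := F)
    x ((s : Cₛ^∞⟮𝓘(ℝ, E); F, V⟯) x)).choose - s) (by simp [h])
  rwa [map_sub, ContMDiffSection.coe_sub, Pi.sub_apply, sub_eq_zero] at this

end Bundle

end Generic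

/-! ### One-forms, vector fields and the Lie bracket as a commutator. -/

section Forms

variable {E : Type u} [NormedAddCommGroup E] [NormedSpace ℝ E]
  {M : Type v} [TopologicalSpace M] [ChartedSpace E M] [IsManifold 𝓘(ℝ, E) ∞ M]

omit [IsManifold 𝓘(ℝ, E) ∞ M] in
theorem contMDiff_trivial_section_iff {n : ℕ∞ω} {f : M → ℝ} {x : M} :
    ContMDiffAt 𝓘(ℝ, E) (𝓘(ℝ, E).prod 𝓘(ℝ, ℝ)) n
      (fun x => TotalSpace.mk' ℝ (E := Bundle.Trivial M ℝ) x (f x)) x ↔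
    ContMDiffAt 𝓘(ℝ, E) 𝓘(ℝ, ℝ) n f x := by
  rw [contMDiffAt_section]
  rfl

theorem contMDiff_pairing (α : OneForm E M) (X : VecField E M) :
    ContMDiff 𝓘(ℝ, E) 𝓘(ℝ, ℝ) ∞ fun x => (α x : TSpace E M x →L[ℝ] ℝ) (X x) := by
  have h := ContMDiff.clm_bundle_apply α.contMDiff X.contMDiff
  exact fun x => contMDiff_trivial_section_iff.1 (h x)

/-- The pairing of a one-form and a vector field, as a smooth function. -/
def pairing (α : OneForm E M) (X : VecField E M) : C^∞⟮𝓘(ℝ, E), M; ℝ⟯ :=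
  ⟨_, contMDiff_pairing α X⟩

theorem pairing_apply (α : OneForm E M) (X : VecField E M) (x : M) :
    pairing α X x = (α x : TSpace E M x →L[ℝ] ℝ) (X x) := rfl

variable [FiniteDimensional ℝ E] [T2Space M]

section Hom

variable {F : Type*} [NormedAddCommGroup F] [NormedSpace ℝ F] [FiniteDimensional ℝ F]
  {V : M → Type*} [TopologicalSpace (TotalSpace F V)]
  [∀ x, TopologicalSpace (V x)] [FiberBundle F V]
  [∀ x, AddCommGroup (V x)] [∀ x, Module ℝ (V x)] [VectorBundle ℝ F V]
  [ContMDiffVectorBundle ∞ F V 𝓘(ℝ, E)]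
  {F' : Type*} [NormedAddCommGroup F'] [NormedSpace ℝ F']
  {V' : M → Type*} [TopologicalSpace (TotalSpace F' V')]
  [∀ x, TopologicalSpace (V' x)] [FiberBundle F' V']
  [∀ x, AddCommGroup (V' x)] [∀ x, Module ℝ (V' x)] [VectorBundle ℝ F' V']
  [ContMDiffVectorBundle ∞ F' V' 𝓘(ℝ, E)]
  [∀ x, IsTopologicalAddGroup (V' x)] [∀ x, ContinuousSMul ℝ (V' x)]

/-- A field of linear maps is smooth as soon as it maps smooth sections to smooth sections. -/
theorem contMDiff_hom_of_apply (S : ∀ x, V x →L[ℝ] V' x)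
    (h : ∀ s : Cₛ^∞⟮𝓘(ℝ, E); F, V⟯, ContMDiff 𝓘(ℝ, E) (𝓘(ℝ, E).prod 𝓘(ℝ, F')) ∞
      (fun x => TotalSpace.mk' F' x (S x (s x)))) :
    ContMDiff 𝓘(ℝ, E) (𝓘(ℝ, E).prod 𝓘(ℝ, F →L[ℝ] F')) ∞
      (fun x => TotalSpace.mk' (F →L[ℝ] F') (E := fun x => V x →L[ℝ] V' x) x (S x)) := by
  intro x
  rw [contMDiffAt_hom_bundle]
  refine ⟨contMDiffAt_id, ?_⟩
  let b := finBasis ℝ F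
  let e := trivializationAt F V x
  let e' := trivializationAt F' V' x
  have hxe : x ∈ e.baseSet := FiberBundle.mem_baseSet_trivializationAt F V x
  have hxe' : x ∈ e'.baseSet := FiberBundle.mem_baseSet_trivializationAt F' V' x
  have key : ∀ i, ContMDiffAt 𝓘(ℝ, E) 𝓘(ℝ, F') ∞ (fun y =>
      ContinuousLinearMap.inCoordinates F V F' V' x y x y (S y) (b i)) x := by
    intro i
    obtain ⟨χ, t, -, ht, -, h1⟩ := exists_section_eventuallyEq e.open_baseSet hxe
      (e.contMDiffOn_localFrame_baseSet (I := 𝓘(ℝ, E)) ∞ b i)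
    have h2 := (e'.contMDiffAt_section_iff hxe').1 (h t x)
    refine h2.congr_of_eventuallyEq ?_
    filter_upwards [h1, e.open_baseSet.mem_nhds hxe, e'.open_baseSet.mem_nhds hxe'] with y hy hye hye'
    rw [ContinuousLinearMap.inCoordinates_eq hye hye', ht, hy, one_smul,
      e.localFrame_apply_of_mem_baseSet b hye]
    simp [Bundle.Trivialization.basisAt, e', e]
  have hsum : ∀ A : F →L[ℝ] F', A = ∑ i, ContinuousLinearMap.smulRightL ℝ F F'
      (b.coord i).toContinuousLinearMap (A (b i)) := by
    intro A
    ext v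
    conv_lhs => rw [← b.sum_repr v, map_sum]
    simp
  refine ContMDiffAt.congr_of_eventuallyEq (f := fun y => ∑ i, ContinuousLinearMap.smulRightL ℝ F F'
      (b.coord i).toContinuousLinearMap
      (ContinuousLinearMap.inCoordinates F V F' V' x y x y (S y) (b i))) ?_
      (Eventually.of_forall fun y => hsum _)
  refine ContMDiffAt.sum fun i _ => ?_
  exact (ContinuousLinearMap.contMDiff _).contMDiffAt.comp x (key i)

end Hom

omit [IsManifold 𝓘(ℝ, E) ∞ M] [FiniteDimensional ℝ E] [T2Space M] in
theorem differential_congr {f g : M → ℝ} {x : M} (h : ∀ᶠ y in 𝓝 x, f y = g y) :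
    (differential f x : CoTSpace E M x) = differential g x :=
  EventuallyEq.mfderiv_eq h

/-- The differential of a smooth function as a smooth one-form. -/
def dForm (f : C^∞⟮𝓘(ℝ, E), M; ℝ⟯) : OneForm E M :=
  ⟨fun x => differential f x, contMDiff_hom_of_apply (F := E) (F' := ℝ) (V := TSpace E M)
    (V' := Bundle.Trivial M ℝ) _ fun X x => by
      refine contMDiff_trivial_section_iff.2 ?_
      have h1 := (f.contMDiff.contMDiff_tangentMap (m := ∞) (by simp)).comp X.contMDiff
      have h2 := (contMDiff_snd_tangentBundle_modelSpace ℝ 𝓘(ℝ, ℝ) (n := ∞)).comp h1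
      exact h2 x⟩

theorem dForm_apply (f : C^∞⟮𝓘(ℝ, E), M; ℝ⟯) (x : M) : dForm f x = differential f x := rfl

theorem exists_differential_eq (x : M) (c : CoTSpace E M x) :
    ∃ f : C^∞⟮𝓘(ℝ, E), M; ℝ⟯, differential f x = c := by
  let c' : E →L[ℝ] ℝ := c
  have hs : ContMDiffOn 𝓘(ℝ, E) 𝓘(ℝ, ℝ) ∞ (c' ∘ extChartAt 𝓘(ℝ, E) x)
      (chartAt E x).source :=
    c'.contMDiff.comp_contMDiffOn contMDiffOn_extChartAt
  obtain ⟨f, hf⟩ := exists_contMDiffMap_eventuallyEq (chartAt E x).open_source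
    (mem_chart_source E x) hs
  refine ⟨f, ?_⟩
  rw [differential_congr hf]
  have h1 := mfderiv_comp x (I := 𝓘(ℝ, E)) (I' := 𝓘(ℝ, E)) (I'' := 𝓘(ℝ, ℝ))
    ((c'.contMDiff (n := 1)).mdifferentiableAt one_ne_zero) (mdifferentiableAt_extChartAt (mem_chart_source E x))
  unfold differential
  rw [h1, mfderiv_extChartAt_self, ContinuousLinearMap.mfderiv_eq]
  rfl

omit [FiniteDimensional ℝ E] [T2Space M] [IsManifold 𝓘(ℝ, E) ∞ M] in
theorem exists_covector_ne_zero [FiniteDimensional ℝ E] {x : M} {v : TSpace E M x} (hv : v ≠ 0) :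
    ∃ c : CoTSpace E M x, (c : TSpace E M x →L[ℝ] ℝ) v ≠ 0 := by
  obtain ⟨c, -, hc⟩ := exists_dual_vector ℝ (E := E) v (norm_ne_zero_iff.2 hv)
  refine ⟨c, ?_⟩
  change c v ≠ 0
  rw [hc]
  exact_mod_cast (norm_ne_zero_iff (E := E)).2 hv

omit [FiniteDimensional ℝ E] [T2Space M] in
theorem isManifold_minSmoothness (n : ℕ) : IsManifold 𝓘(ℝ, E) (minSmoothness ℝ n) M := by
  rw [minSmoothness_of_isRCLikeNormedField]
  exact .of_le (n := ∞) (by exact_mod_cast le_top)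

/-- The Lie bracket of smooth vector fields. -/
def lieBracket (V W : VecField E M) : VecField E M :=
  ⟨VectorField.mlieBracket 𝓘(ℝ, E) (fun y => V y) (fun y => W y), fun x =>
    have := isManifold_minSmoothness (E := E) (M := M) 2
    have : IsManifold 𝓘(ℝ, E) (((⊤ : ℕ∞) : ℕ∞ω) + 1) M := .of_le (n := ∞) (by exact_mod_cast le_top)
    ContMDiffAt.mlieBracket_vectorField (m := ⊤) (n := ⊤) (V.contMDiff x) (W.contMDiff x) (by simp)⟩

omit [FiniteDimensional ℝ E] [T2Space M] in
theorem mdifferentiable_vecField (V : VecField E M) :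
    MDifferentiable 𝓘(ℝ, E) 𝓘(ℝ, E).tangent
      (fun y => (TotalSpace.mk' E y (V y) : TangentBundle 𝓘(ℝ, E) M)) :=
  V.contMDiff.mdifferentiable (by simp)

omit [T2Space M] in
theorem lieBracket_swap (V W : VecField E M) : lieBracket V W = - lieBracket W V :=
  ContMDiffSection.ext fun _ => VectorField.mlieBracket_swap_apply

omit [T2Space M] in
theorem lieBracket_add_right (V W W' : VecField E M) :
    lieBracket V (W + W') = lieBracket V W + lieBracket V W' :=
  ContMDiffSection.ext fun x => VectorField.mlieBracket_add_right (mdifferentiable_vecField W x)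
    (mdifferentiable_vecField W' x)

theorem lieBracket_smul_right (V W : VecField E M) (f : C^∞⟮𝓘(ℝ, E), M; ℝ⟯) :
    lieBracket V (f • W) = pairing (dForm f) V • W + f • lieBracket V W :=
  ContMDiffSection.ext fun x => VectorField.mlieBracket_smul_right
    (f.contMDiff.mdifferentiable (by simp) x) (mdifferentiable_vecField W x)

omit [T2Space M] in
theorem lieBracket_leibniz (U V W : VecField E M) : lieBracket U (lieBracket V W) =
    lieBracket (lieBracket U V) W + lieBracket V (lieBracket U W) := by
  have : IsManifold 𝓘(ℝ, E) (minSmoothness ℝ 3) M := isManifold_minSmoothness 3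
  have h2 : minSmoothness ℝ 2 ≤ ∞ := by
    rw [minSmoothness_of_isRCLikeNormedField]
    exact ENat.LEInfty.out
  exact ContMDiffSection.ext fun x => VectorField.leibniz_identity_mlieBracket_apply
    ((U.contMDiff x).of_le h2) ((V.contMDiff x).of_le h2) ((W.contMDiff x).of_le h2)

/-- The Lie bracket acts on functions as the commutator of derivations. -/
theorem pairing_dForm_lieBracket (h : C^∞⟮𝓘(ℝ, E), M; ℝ⟯) (V W : VecField E M) :
    pairing (dForm h) (lieBracket V W) =
      pairing (dForm (pairing (dForm h) W)) V - pairing (dForm (pairing (dForm h) V)) W := by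
  refine ContMDiffMap.ext fun x => ?_
  by_cases hE : ∃ z : TSpace E M x, z ≠ 0
  swap
  · push Not at hE
    change (dForm h x : TSpace E M x →L[ℝ] ℝ) _ = (dForm (pairing (dForm h) W) x :
      TSpace E M x →L[ℝ] ℝ) _ - (dForm (pairing (dForm h) V) x : TSpace E M x →L[ℝ] ℝ) _
    rw [hE (V x), hE (W x), hE (lieBracket V W x)]
    simp
  obtain ⟨z, hz⟩ := hE
  obtain ⟨⟨Z, hZc⟩, hZ⟩ := exists_compactSection_apply_eq (E := E) (F := E) (V := TSpace E M) x z
  -- The Leibniz identity for `h • Z`, minus `h` times the one for `Z`, leaves the claim multiplied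
  -- by `Z`; since `Z x ≠ 0`, that factor cancels at `x`.
  have key : pairing (dForm h) (lieBracket V W) • Z =
      (pairing (dForm (pairing (dForm h) W)) V - pairing (dForm (pairing (dForm h) V)) W) • Z := by
    have h1 := lieBracket_leibniz V W (h • Z)
    have h2 := lieBracket_leibniz V W Z
    simp only [lieBracket_smul_right, lieBracket_add_right] at h1
    linear_combination (norm := module) h • h2 - h1
  have := congrArg (fun s : VecField E M => s x) key
  simp only [smul_section_apply] at this
  rw [show Z x = z from hZ] at this
  exact smul_left_injective ℝ hz this

end Forms

/-! ### Dual frames, distributions and closedness of tangency. -/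

section Frames

variable {E : Type u} [NormedAddCommGroup E] [NormedSpace ℝ E]
  {M : Type v} [TopologicalSpace M] [ChartedSpace E M] [IsManifold 𝓘(ℝ, E) ∞ M]

theorem pairing_sum_smul {ι : Type*} (s : Finset ι) (θ : OneForm E M) (f : ι → C^∞⟮𝓘(ℝ, E), M; ℝ⟯)
    (X : ι → VecField E M) : pairing θ (∑ i ∈ s, f i • X i) = ∑ i ∈ s, f i * pairing θ (X i) := by
  classical
  induction s using Finset.induction_on with
  | empty =>
    refine ContMDiffMap.ext fun x => ?_
    change (θ x : TSpace E M x →L[ℝ] ℝ) 0 = 0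
    exact map_zero _
  | insert a t ha ih =>
    rw [Finset.sum_insert ha, Finset.sum_insert ha, ← ih]
    refine ContMDiffMap.ext fun x => ?_
    change (θ x : TSpace E M x →L[ℝ] ℝ) (f a x • X a x + (∑ i ∈ t, f i • X i : VecField E M) x) = 
      f a x * (θ x : TSpace E M x →L[ℝ] ℝ) (X a x) + (θ x : TSpace E M x →L[ℝ] ℝ) _
    rw [map_add, map_smul]
    rfl

/-- Evaluation at a point, as a ring homomorphism. -/
def evalHom (x : M) : C^∞⟮𝓘(ℝ, E), M; ℝ⟯ →+* ℝ where
  toFun f := f x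
  map_one' := rfl
  map_mul' _ _ := rfl
  map_zero' := rfl
  map_add' _ _ := rfl

variable [FiniteDimensional ℝ E] [T2Space M]

/-- The pairing matrix is the identity at `x`, so it stays invertible nearby; its inverse, as
adjugate over determinant, corrects `Z` to a frame dual to `θ`. -/
theorem exists_matrix_dual {k : ℕ} (θ : Fin k → OneForm E M) (Z : Fin k → VecField E M) (x : M)
    (h : ∀ i j, pairing (θ i) (Z j) x = if i = j then 1 else 0) :
    ∃ n : Matrix (Fin k) (Fin k) C^∞⟮𝓘(ℝ, E), M; ℝ⟯, ∀ᶠ y in 𝓝 x, ∀ i j,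
      pairing (θ i) (∑ l, n l j • Z l) y = if i = j then 1 else 0 := by
  let m : Matrix (Fin k) (Fin k) C^∞⟮𝓘(ℝ, E), M; ℝ⟯ := fun i j => pairing (θ i) (Z j)
  have hdet : m.det x ≠ 0 := by
    have h1 : evalHom x m.det = ((evalHom x).mapMatrix m).det := RingHom.map_det _ _
    have h2 : (evalHom x).mapMatrix m = 1 := by
      ext i j
      exact (h i j).trans (Matrix.one_apply (α := ℝ)).symm
    rw [h2, Matrix.det_one] at h1
    exact (h1.trans_ne one_ne_zero)
  have hU : IsOpen {y | m.det y ≠ 0} := isOpen_ne_fun m.det.contMDiff.continuous continuous_const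
  obtain ⟨g, hg⟩ := exists_contMDiffMap_eventuallyEq hU hdet (f := fun y => (m.det y)⁻¹)
    (fun y hy => (m.det.contMDiff.contMDiffAt.inv₀ hy).contMDiffWithinAt)
  refine ⟨g • m.adjugate, ?_⟩
  filter_upwards [hg, hU.mem_nhds hdet] with y hy hyU i j
  have h3 : pairing (θ i) (∑ l, (g • m.adjugate) l j • Z l) = g * (m * m.adjugate) i j := by
    rw [pairing_sum_smul, Matrix.mul_apply, Finset.mul_sum]
    refine Finset.sum_congr rfl fun l _ => ?_
    rw [Matrix.smul_apply, smul_eq_mul, mul_assoc]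
    congr 1
    exact mul_comm _ _
  rw [h3, Matrix.mul_adjugate, Matrix.smul_apply, Matrix.one_apply]
  change g y * (m.det y * (ite (i = j) (1 : C^∞⟮𝓘(ℝ, E), M; ℝ⟯) 0) y) = _
  have hyU' : m.det y ≠ 0 := hyU
  rw [hy, inv_mul_cancel_left₀ hyU']
  split_ifs <;> rfl

omit [IsManifold 𝓘(ℝ, E) ∞ M] [T2Space M] in
theorem exists_dual_covectors {k : ℕ} {x : M} {v : Fin k → TSpace E M x}
    (hv : LinearIndependent ℝ v) : ∃ c : Fin k → CoTSpace E M x,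
      ∀ i j, (c i : TSpace E M x →L[ℝ] ℝ) (v j) = if i = j then 1 else 0 := by
  have : FiniteDimensional ℝ (TSpace E M x) := inferInstanceAs (FiniteDimensional ℝ E)
  have : T2Space (TSpace E M x) := inferInstanceAs (T2Space E)
  obtain ⟨g, hg⟩ := LinearMap.exists_leftInverse_of_injective (Fintype.linearCombination ℝ v)
    (LinearMap.ker_eq_bot.2 (linearIndependent_iff_injective_fintypeLinearCombination.1 hv))
  let c (i : Fin k) : TSpace E M x →ₗ[ℝ] ℝ := LinearMap.proj i ∘ₗ g
  refine ⟨fun i => LinearMap.toContinuousLinearMap (c i), fun i j => ?_⟩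
  have := congrArg (fun f => f (Pi.single j 1) i) hg
  simp only [LinearMap.comp_apply, Fintype.linearCombination_apply_single, one_smul,
    LinearMap.id_apply, Pi.single_apply] at this
  exact this

/-- Vector fields `X` spanning the subspaces `D` on the neighbourhood `U` of `x`, with dual
one-forms `θ`. -/
structure IsDualFrame (D : ∀ x : M, Submodule ℝ (TSpace E M x)) (x : M) (U : Set M) {k : ℕ}
    (X : Fin k → VecField E M) (θ : Fin k → OneForm E M) : Prop where
  isOpen : IsOpen U
  mem : x ∈ U
  dual : ∀ y ∈ U, ∀ i j, pairing (θ i) (X j) y = if i = j then 1 else 0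
  mem_D : ∀ y i, X i y ∈ D y
  expand : ∀ y ∈ U, ∀ v ∈ D y, v = ∑ i, (θ i y : TSpace E M y →L[ℝ] ℝ) v • X i y

/-- The forms `θ` map `D y` onto `ℝ^k`, so the dimension bound turns this map into an isomorphism;
its inverse is the expansion in the corrected frame. Only an upper bound on the dimension is needed,
which is why local maximality of the rank of `π` suffices later. -/
theorem exists_isDualFrame_of_pairing {D : ∀ x : M, Submodule ℝ (TSpace E M x)} {k : ℕ}
    {Z : Fin k → VecField E M} {θ : Fin k → OneForm E M} {x : M} (hZ : ∀ y i, Z i y ∈ D y)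
    (hθ : ∀ i j, pairing (θ i) (Z j) x = if i = j then 1 else 0)
    (hD : ∀ᶠ y in 𝓝 x, finrank ℝ (D y) ≤ k) :
    ∃ (n : Matrix (Fin k) (Fin k) C^∞⟮𝓘(ℝ, E), M; ℝ⟯) (U : Set M),
      IsDualFrame D x U (fun j => ∑ l, n l j • Z l) θ := by
  obtain ⟨n, hn⟩ := exists_matrix_dual θ Z x hθ
  obtain ⟨U, hU, hUo, hxU⟩ := mem_nhds_iff.1 (hn.and hD)
  have hX : ∀ y i, (∑ l, n l i • Z l : VecField E M) y ∈ D y := fun y i => by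
    rw [section_sum_apply]
    exact sum_mem fun l _ => (D y).smul_mem _ (hZ y l)
  refine ⟨n, U, hUo, hxU, fun y hy => (hU hy).1, hX, fun y hy v hv => ?_⟩
  have hfd : FiniteDimensional ℝ (TSpace E M y) := inferInstanceAs (FiniteDimensional ℝ E)
  obtain ⟨hdual, hfin⟩ := hU hy
  let Θ : D y →ₗ[ℝ] (Fin k → ℝ) := LinearMap.pi fun i =>
    (θ i y : TSpace E M y →L[ℝ] ℝ).toLinearMap ∘ₗ (D y).subtype
  have hΘX : ∀ j, Θ ⟨_, hX y j⟩ = Pi.single j 1 := by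
    intro j
    ext i
    rw [Pi.single_apply]
    exact hdual i j
  have hright : ∀ a : Fin k → ℝ, Θ (∑ j, a j • ⟨_, hX y j⟩) = a := by
    intro a
    rw [map_sum]
    simp_rw [map_smul, hΘX]
    ext i
    simp [Pi.single_apply]
  have hsurj : Function.Surjective Θ := fun a => ⟨_, hright a⟩
  have hfeq : finrank ℝ (D y) = finrank ℝ (Fin k → ℝ) := by
    refine le_antisymm (by simpa using hfin) ?_
    exact LinearMap.finrank_le_finrank_of_surjective hsurj
  have hinj := (LinearMap.injective_iff_surjective_of_finrank_eq_finrank hfeq).2 hsurj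
  have := congrArg Subtype.val (hinj (hright (Θ ⟨v, hv⟩))).symm
  rwa [AddSubmonoidClass.coe_finsetSum] at this

theorem exists_isDualFrame {D : ∀ x : M, Submodule ℝ (TSpace E M x)} {k : ℕ}
    {Z : Fin k → VecField E M} {x : M} (hZ : ∀ y i, Z i y ∈ D y)
    (hli : LinearIndependent ℝ fun i => Z i x) (hD : ∀ᶠ y in 𝓝 x, finrank ℝ (D y) ≤ k) :
    ∃ (n : Matrix (Fin k) (Fin k) C^∞⟮𝓘(ℝ, E), M; ℝ⟯) (U : Set M) (θ : Fin k → OneForm E M),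
      IsDualFrame D x U (fun j => ∑ l, n l j • Z l) θ := by
  obtain ⟨c, hc⟩ := exists_dual_covectors hli
  choose θ hθ using fun i => exists_compactSection_apply_eq (E := E) (F := E →L[ℝ] ℝ)
    (V := CoTSpace E M) x (c i)
  obtain ⟨n, U, h⟩ := exists_isDualFrame_of_pairing (θ := fun i => (θ i : OneForm E M)) hZ
    (fun i j => by rw [pairing_apply, hθ, hc]) hD
  exact ⟨n, U, _, h⟩

omit [FiniteDimensional ℝ E] [T2Space M] in
theorem IsDualFrame.eq_span {D : ∀ x : M, Submodule ℝ (TSpace E M x)} {x : M} {U : Set M} {k : ℕ}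
    {X : Fin k → VecField E M} {θ : Fin k → OneForm E M} (hF : IsDualFrame D x U X θ) {y : M}
    (hy : y ∈ U) : D y = Submodule.span ℝ (Set.range fun i => X i y) := by
  refine le_antisymm (fun v hv => ?_) (Submodule.span_le.2 ?_)
  · rw [hF.expand y hy v hv]
    exact sum_mem fun i _ => Submodule.smul_mem _ _ (Submodule.subset_span ⟨i, rfl⟩)
  · rintro _ ⟨i, rfl⟩
    exact hF.mem_D y i

omit [FiniteDimensional ℝ E] [T2Space M] in
theorem IsDualFrame.finrank_eq {D : ∀ x : M, Submodule ℝ (TSpace E M x)} {x : M} {U : Set M}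
    {k : ℕ} {X : Fin k → VecField E M} {θ : Fin k → OneForm E M} (hF : IsDualFrame D x U X θ)
    {y : M} (hy : y ∈ U) : finrank ℝ (D y) = k := by
  rw [hF.eq_span hy, finrank_span_eq_card, Fintype.card_fin]
  rw [Fintype.linearIndependent_iff]
  intro g hg i
  have h1 := congrArg (fun v => (θ i y : TSpace E M y →L[ℝ] ℝ) v) hg
  simp only [map_sum, map_smul] at h1
  have h2 : ∀ j, (θ i y : TSpace E M y →L[ℝ] ℝ) (X j y) = if i = j then 1 else 0 :=
    fun j => hF.dual y hy i j
  simpa [h2] using h1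

theorem IsDistribution.exists_isDualFrame {D : ∀ x : M, Submodule ℝ (TSpace E M x)}
    (hD : IsDistribution D) : ∃ k : ℕ, ∀ x, ∃ (U : Set M) (X : Fin k → VecField E M)
      (θ : Fin k → OneForm E M), IsDualFrame D x U X θ := by
  obtain ⟨k, hk, hD⟩ := hD
  refine ⟨k, fun x => ?_⟩
  have hfd : FiniteDimensional ℝ (TSpace E M x) := inferInstanceAs (FiniteDimensional ℝ E)
  obtain ⟨U, X, hU, hx, hX, hspan⟩ := hD x
  choose χ Z hZc hZ h0 h1 using fun i => exists_section_eventuallyEq (V := TSpace E M) hU hx (hX i)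
  have hmem : ∀ y i, Z i y ∈ D y := fun y i => by
    rw [hZ]
    by_cases hy : y ∈ U
    · rw [hspan y hy]
      exact Submodule.smul_mem _ _ (Submodule.subset_span ⟨i, rfl⟩)
    · rw [h0 i y hy, zero_smul]
      exact zero_mem _
  have hli : LinearIndependent ℝ fun i => Z i x := by
    have : (fun i => Z i x) = fun i => X i x := by
      ext i
      rw [hZ, (h1 i).self_of_nhds, one_smul]
    rw [this, linearIndependent_iff_card_eq_finrank_span, Set.finrank, ← hspan x hx, hk]
    simp
  obtain ⟨n, W, θ, h⟩ := AlmostRegularPoisson.exists_isDualFrame hmem hli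
    (Eventually.of_forall fun y => (hk y).le)
  exact ⟨W, _, θ, h⟩

omit [FiniteDimensional ℝ E] [T2Space M] in
theorem IsDistribution.of_isDualFrame {D : ∀ x : M, Submodule ℝ (TSpace E M x)} {k : ℕ}
    (h : ∀ x, ∃ (U : Set M) (X : Fin k → VecField E M) (θ : Fin k → OneForm E M),
      IsDualFrame D x U X θ) : IsDistribution D := by
  refine ⟨k, fun x => ?_, fun x => ?_⟩
  · obtain ⟨U, X, θ, hF⟩ := h x
    exact hF.finrank_eq hF.mem
  · obtain ⟨U, X, θ, hF⟩ := h x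
    exact ⟨U, fun i y => X i y, hF.isOpen, hF.mem, fun i => (X i).contMDiff.contMDiffOn,
      fun y hy => hF.eq_span hy⟩

theorem vecField_apply_eq_zero {W : VecField E M} {S : Set M} (hS : Dense S) {x : M}
    (h : ∀ᶠ y in 𝓝 x, y ∈ S → W y = 0) : W x = 0 := by
  by_contra hne
  obtain ⟨c, hc⟩ := exists_covector_ne_zero hne
  obtain ⟨β, hβ⟩ := exists_compactSection_apply_eq (E := E) (F := E →L[ℝ] ℝ)
    (V := CoTSpace E M) x c
  have h1 : ∀ᶠ y in 𝓝 x, pairing β W y ≠ 0 :=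
    (pairing β.1 W).contMDiff.continuous.continuousAt.eventually_ne (by
      rw [pairing_apply, hβ]; exact hc)
  obtain ⟨y, hyS, hy⟩ := hS.inter_nhds_nonempty (h.and h1)
  refine hy.2 ?_
  rw [pairing_apply, hy.1 hyS]
  exact map_zero _

/-- A smooth vector field which is tangent to a distribution on a dense set is tangent to it. -/
theorem IsDistribution.mem_of_dense {D : ∀ x : M, Submodule ℝ (TSpace E M x)}
    (hD : IsDistribution D) {W : VecField E M} {S : Set M} (hS : Dense S)
    (h : ∀ y ∈ S, W y ∈ D y) (x : M) : W x ∈ D x := by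
  obtain ⟨k, hk⟩ := hD.exists_isDualFrame
  obtain ⟨U, X, θ, hF⟩ := hk x
  -- In a dual frame, tangency of `W` to `D` is the vanishing of a smooth field, a closed condition.
  have h0 : (W - ∑ i, pairing (θ i) W • X i : VecField E M) x = 0 := by
    refine vecField_apply_eq_zero hS ?_
    filter_upwards [hF.isOpen.mem_nhds hF.mem] with y hy hyS
    rw [ContMDiffSection.coe_sub, Pi.sub_apply, section_sum_apply, sub_eq_zero]
    exact hF.expand y hy _ (h y hyS)
  rw [ContMDiffSection.coe_sub, Pi.sub_apply, section_sum_apply, sub_eq_zero] at h0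
  rw [h0]
  exact sum_mem fun i _ => Submodule.smul_mem _ _ (hF.mem_D x i)

theorem IsDistribution.le_of_dense {D D' : ∀ x : M, Submodule ℝ (TSpace E M x)}
    (hD : IsDistribution D) (hD' : IsDistribution D') {S : Set M} (hS : Dense S)
    (h : ∀ y ∈ S, D y ≤ D' y) (x : M) : D x ≤ D' x := by
  intro v hv
  obtain ⟨k, hk⟩ := hD.exists_isDualFrame
  obtain ⟨U, X, θ, hF⟩ := hk x
  rw [hF.expand x hF.mem v hv]
  exact sum_mem fun i _ => Submodule.smul_mem _ _
    (hD'.mem_of_dense hS (fun y hy => h y hy (hF.mem_D y i)) x)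

/-- Local coordinate functions whose differentials form a coframe, with the dual frame. -/
theorem exists_coordinates (x : M) : ∃ (U : Set M) (X : Fin (finrank ℝ E) → VecField E M)
    (f : Fin (finrank ℝ E) → C^∞⟮𝓘(ℝ, E), M; ℝ⟯),
      IsDualFrame (fun _ => ⊤) x U X fun i => dForm (f i) := by
  have hfd : FiniteDimensional ℝ (TSpace E M x) := inferInstanceAs (FiniteDimensional ℝ E)
  let b : Basis (Fin (finrank ℝ E)) ℝ (TSpace E M x) := finBasis ℝ E
  choose Z hZ using fun i => exists_compactSection_apply_eq (E := E) (F := E)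
    (V := TSpace E M) x (b i)
  obtain ⟨c, hc⟩ := exists_dual_covectors b.linearIndependent
  choose f hf using fun i => exists_differential_eq x (c i)
  obtain ⟨n, U, h⟩ := exists_isDualFrame_of_pairing (D := fun _ => ⊤) (x := x)
    (θ := fun i => dForm (f i)) (Z := fun i => (Z i : VecField E M)) (fun _ _ => trivial)
    (fun i j => by rw [pairing_apply, hZ, dForm_apply, hf, hc])
    (Eventually.of_forall fun y => by rw [finrank_top]; exact le_rfl)
  exact ⟨U, _, f, h⟩

omit [FiniteDimensional ℝ E] [T2Space M] in
theorem IsDualFrame.covector_apply {D : ∀ x : M, Submodule ℝ (TSpace E M x)} {x : M} {U : Set M}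
    {k : ℕ} {X : Fin k → VecField E M} {θ : Fin k → OneForm E M} (hF : IsDualFrame D x U X θ)
    {y : M} (hy : y ∈ U) (c : CoTSpace E M y) {v : TSpace E M y} (hv : v ∈ D y) :
    (c : TSpace E M y →L[ℝ] ℝ) v =
      ∑ i, (c : TSpace E M y →L[ℝ] ℝ) (X i y) * (θ i y : TSpace E M y →L[ℝ] ℝ) v := by
  conv_lhs => rw [hF.expand y hy v hv]
  rw [map_sum]
  refine Finset.sum_congr rfl fun i _ => ?_
  rw [map_smul, smul_eq_mul, mul_comm]

omit [FiniteDimensional ℝ E] [T2Space M] in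
theorem IsDualFrame.covector_eq_sum {x : M} {U : Set M} {k : ℕ} {X : Fin k → VecField E M}
    {θ : Fin k → OneForm E M} (hF : IsDualFrame (fun _ => ⊤) x U X θ)
    {y : M} (hy : y ∈ U) (c : CoTSpace E M y) :
    c = ∑ i, (c : TSpace E M y →L[ℝ] ℝ) (X i y) • θ i y := by
  refine ContinuousLinearMap.ext fun v => ?_
  rw [_root_.sum_apply]
  exact hF.covector_apply hy c trivial

end Frames

/-! ### The sharp map, Hamiltonian vector fields and involutivity. -/

namespace PoissonStructure

variable {E : Type u} [NormedAddCommGroup E] [NormedSpace ℝ E]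
  {M : Type v} [TopologicalSpace M] [ChartedSpace E M] [IsManifold 𝓘(ℝ, E) ∞ M]
  (P : PoissonStructure E M)

/-- The sharp map as a `C^∞(M)`-linear map from one-forms to vector fields. -/
def sharpHom : OneForm E M →ₗ[C^∞⟮𝓘(ℝ, E), M; ℝ⟯] VecField E M where
  toFun α := ⟨fun x => P.sharp x (α x), ContMDiff.clm_bundle_apply P.smooth α.contMDiff⟩
  map_add' α β := ContMDiffSection.ext fun x => map_add (P.sharp x) (α x) (β x)
  map_smul' f α := ContMDiffSection.ext fun x => map_smul (P.sharp x) (f x) (α x)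

theorem sharpHom_apply (α : OneForm E M) (x : M) : P.sharpHom α x = P.sharp x (α x) := rfl

/-- The range of the sharp map at a point. -/
abbrev rangeAt (x : M) : Submodule ℝ (TSpace E M x) :=
  LinearMap.range (P.sharp x : CoTSpace E M x →ₗ[ℝ] TSpace E M x)

theorem sharp_mem_rangeAt {x : M} (α : CoTSpace E M x) : P.sharp x α ∈ P.rangeAt x := ⟨α, rfl⟩

/-- A covector vanishing on the range of the sharp map is in its kernel. -/
theorem sharp_eq_zero_of_forall [FiniteDimensional ℝ E] {x : M} {α : CoTSpace E M x}
    (h : ∀ v ∈ P.rangeAt x, (α : TSpace E M x →L[ℝ] ℝ) v = 0) : P.sharp x α = 0 := by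
  by_contra hne
  obtain ⟨c, hc⟩ := exists_covector_ne_zero hne
  refine hc ?_
  have h1 := P.skew x α c
  have h2 : α (P.sharp x c) = 0 := h _ (P.sharp_mem_rangeAt c)
  rw [h2, neg_zero] at h1
  exact h1

theorem apply_eq_zero_of_mem_rangeAt {x : M} {α : CoTSpace E M x} (h : P.sharp x α = 0)
    {v : TSpace E M x} (hv : v ∈ P.rangeAt x) : (α : TSpace E M x →L[ℝ] ℝ) v = 0 := by
  obtain ⟨β, rfl⟩ := hv
  have h1 := P.skew x β α
  have h2 : β (P.sharp x α) = 0 := by rw [h]; exact map_zero _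
  rw [h2, neg_zero] at h1
  exact h1

variable [FiniteDimensional ℝ E] [T2Space M]

theorem leafTangent_eq (x : M) : P.leafTangent x = P.rangeAt x := by
  refine le_antisymm ?_ ?_
  · rintro _ ⟨X, ⟨α, -, hX⟩, rfl⟩
    exact ⟨α x, (hX x).symm⟩
  · rintro _ ⟨c, rfl⟩
    obtain ⟨α, hα⟩ := exists_compactSection_apply_eq (E := E) (F := E →L[ℝ] ℝ)
      (V := CoTSpace E M) x c
    refine ⟨P.sharpHom α, ⟨α, α.2, fun y => rfl⟩, ?_⟩
    rw [sharpHom_apply, hα]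
    rfl

/-- Near a point where the rank is locally maximal, the range of the sharp map is spanned by the
images of one-forms. -/
theorem exists_isDualFrame_rangeAt {x : M} (hx : ∀ᶠ y in 𝓝 x, P.rank y ≤ P.rank x) :
    ∃ (α : Fin (P.rank x) → OneForm E M) (U : Set M) (θ : Fin (P.rank x) → OneForm E M),
      IsDualFrame P.rangeAt x U (fun i => P.sharpHom (α i)) θ := by
  have hfd : FiniteDimensional ℝ (TSpace E M x) := inferInstanceAs (FiniteDimensional ℝ E)
  let b : Basis (Fin (P.rank x)) ℝ (P.rangeAt x) := finBasis ℝ _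
  choose c hc using fun i => (b i).2
  choose β hβ using fun i => exists_compactSection_apply_eq (E := E) (F := E →L[ℝ] ℝ)
      (V := CoTSpace E M) x (c i)
  have hli : LinearIndependent ℝ fun i => P.sharpHom (β i) x := by
    have h1 : (fun i => P.sharpHom (β i) x) = fun i => (b i : TSpace E M x) := by
      ext i
      rw [sharpHom_apply, hβ]
      exact hc i
    rw [h1]
    exact b.linearIndependent.map' (P.rangeAt x).subtype (Submodule.ker_subtype _)
  obtain ⟨n, U, θ, hF⟩ := exists_isDualFrame (D := P.rangeAt)
    (fun y i => P.sharp_mem_rangeAt ((β i : OneForm E M) y)) hli hx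
  refine ⟨fun j => ∑ l, n l j • (β l : OneForm E M), U, θ, ?_⟩
  have h2 : (fun j => P.sharpHom (∑ l, n l j • (β l : OneForm E M))) =
      fun j => ∑ l, n l j • P.sharpHom (β l) := by
    ext1 j
    rw [map_sum]
    simp_rw [map_smul]
  rw [h2]
  exact hF

/-- Paired with `dh` for arbitrary `h`, this is the Jacobi identity, once the Lie bracket is written
as a commutator of derivations. -/
theorem lieBracket_hamiltonian (f g : C^∞⟮𝓘(ℝ, E), M; ℝ⟯) :
    lieBracket (P.sharpHom (dForm f)) (P.sharpHom (dForm g)) =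
      P.sharpHom (dForm (pairing (dForm g) (P.sharpHom (dForm f)))) := by
  refine ContMDiffSection.ext fun x => ?_
  rw [← sub_eq_zero]
  by_contra hne
  obtain ⟨c, hc⟩ := exists_covector_ne_zero hne
  obtain ⟨h, rfl⟩ := exists_differential_eq x c
  refine hc ?_
  have hskew (a b : C^∞⟮𝓘(ℝ, E), M; ℝ⟯) : pairing (dForm b) (P.sharpHom (dForm a)) =
      - pairing (dForm a) (P.sharpHom (dForm b)) :=
    ContMDiffMap.ext fun y => P.skew y (dForm a y) (dForm b y)
  have hneg (a : C^∞⟮𝓘(ℝ, E), M; ℝ⟯) (V : VecField E M) : pairing (dForm (-a)) V =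
      - pairing (dForm a) V := by
    refine ContMDiffMap.ext fun y => ?_
    have : differential (-a : M → ℝ) y = -differential (E := E) a y := mfderiv_neg
    change (differential (-a : M → ℝ) y : TSpace E M y →L[ℝ] ℝ) _ = - (differential a y : TSpace E M y →L[ℝ] ℝ) _
    rw [this]
    rfl
  have h1 := pairing_dForm_lieBracket h (P.sharpHom (dForm f)) (P.sharpHom (dForm g))
  have h2 := P.jacobi f g h x
  have hb (a b : C^∞⟮𝓘(ℝ, E), M; ℝ⟯) : bracket P.sharp a b =
    pairing (dForm b) (P.sharpHom (dForm a)) := rfl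
  simp only [hb] at h2
  change pairing (dForm (pairing (dForm h) (P.sharpHom (dForm g)))) (P.sharpHom (dForm f)) x +
    pairing (dForm (pairing (dForm f) (P.sharpHom (dForm h)))) (P.sharpHom (dForm g)) x +
    pairing (dForm (pairing (dForm g) (P.sharpHom (dForm f)))) (P.sharpHom (dForm h)) x = 0 at h2
  rw [hskew h f, hneg, hskew h (pairing (dForm g) (P.sharpHom (dForm f)))] at h2
  have h3 := congrArg (fun a : C^∞⟮𝓘(ℝ, E), M; ℝ⟯ => a x) h1
  change (dForm h x : TSpace E M x →L[ℝ] ℝ) (_ - _) = 0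
  rw [map_sub]
  change pairing (dForm h) (lieBracket (P.sharpHom (dForm f)) (P.sharpHom (dForm g))) x -
    pairing (dForm h) (P.sharpHom (dForm (pairing (dForm g) (P.sharpHom (dForm f))))) x = 0
  change _ = pairing (dForm (pairing (dForm h) (P.sharpHom (dForm g)))) (P.sharpHom (dForm f)) x -
    pairing (dForm (pairing (dForm h) (P.sharpHom (dForm f)))) (P.sharpHom (dForm g)) x at h3
  change _ + -(pairing (dForm (pairing (dForm h) (P.sharpHom (dForm f)))) (P.sharpHom (dForm g)) x)
    + - (pairing (dForm h) (P.sharpHom (dForm (pairing (dForm g) (P.sharpHom (dForm f))))) x)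
    = 0 at h2
  rw [h3]
  linarith

omit [T2Space M] in
theorem lieBracket_congr {V V' W W' : VecField E M} {x : M}
    (hV : ∀ᶠ y in 𝓝 x, V y = V' y) (hW : ∀ᶠ y in 𝓝 x, W y = W' y) :
    lieBracket V W x = lieBracket V' W' x :=
  EventuallyEq.mlieBracket_vectorField_eq hV hW

theorem lieBracket_smul_sharpHom_mem {V : VecField E M} {x : M}
    {ι : Type*} (s : Finset ι) (β : ι → OneForm E M) (g : ι → C^∞⟮𝓘(ℝ, E), M; ℝ⟯)
    (h : ∀ i, lieBracket V (P.sharpHom (β i)) x ∈ P.rangeAt x) :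
    lieBracket V (P.sharpHom (∑ i ∈ s, g i • β i)) x ∈ P.rangeAt x := by
  classical
  induction s using Finset.induction_on with
  | empty =>
    have h0 : lieBracket V (P.sharpHom (0 : OneForm E M)) x = 0 := by
      have h1 := lieBracket_add_right V (P.sharpHom 0) (P.sharpHom 0)
      rw [← map_add, add_zero] at h1
      rw [left_eq_add.1 h1]
      rfl
    rw [Finset.sum_empty, h0]
    exact zero_mem _
  | insert a t ha ih =>
    rw [Finset.sum_insert ha, map_add, lieBracket_add_right, map_smul, lieBracket_smul_right]
    refine add_mem (add_mem ?_ ?_) ih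
    · exact Submodule.smul_mem _ _ (P.sharp_mem_rangeAt _)
    · exact Submodule.smul_mem _ _ (h a)

theorem eventually_eq_sum_dForm (A : OneForm E M) (x : M) :
    ∃ (f a : Fin (finrank ℝ E) → C^∞⟮𝓘(ℝ, E), M; ℝ⟯),
      ∀ᶠ y in 𝓝 x, A y = (∑ i, a i • dForm (f i) : OneForm E M) y := by
  obtain ⟨U, X, f, hF⟩ := exists_coordinates (E := E) x
  refine ⟨f, fun i => pairing A (X i), ?_⟩
  filter_upwards [hF.isOpen.mem_nhds hF.mem] with y hy
  rw [section_sum_apply]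
  exact hF.covector_eq_sum hy (A y)

/-- Locally one-forms are combinations of exact ones. The Leibniz rule in each argument produces
extra terms already in the image of `π^♯`, which reduces the claim to Hamiltonian fields. -/
theorem lieBracket_sharpHom_mem (A B : OneForm E M) (x : M) :
    lieBracket (P.sharpHom A) (P.sharpHom B) x ∈ P.rangeAt x := by
  obtain ⟨f, a, hA⟩ := eventually_eq_sum_dForm A x
  obtain ⟨g, b, hB⟩ := eventually_eq_sum_dForm B x
  have hA' : ∀ᶠ y in 𝓝 x, P.sharpHom A y = P.sharpHom (∑ i, a i • dForm (f i)) y :=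
    hA.mono fun y hy => by rw [sharpHom_apply, hy]; rfl
  have hB' : ∀ᶠ y in 𝓝 x, P.sharpHom B y = P.sharpHom (∑ i, b i • dForm (g i)) y :=
    hB.mono fun y hy => by rw [sharpHom_apply, hy]; rfl
  rw [lieBracket_congr hA' hB']
  refine P.lieBracket_smul_sharpHom_mem _ _ _ fun i => ?_
  rw [lieBracket_swap]
  refine Submodule.neg_mem _ (P.lieBracket_smul_sharpHom_mem _ _ _
    fun j => ?_)
  rw [lieBracket_hamiltonian]
  exact P.sharp_mem_rangeAt _

omit [FiniteDimensional ℝ E] [T2Space M] in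
theorem regular_of_rank_le {x y : M} (hx : x ∈ P.regularSet) (h : P.rank x ≤ P.rank y) :
    y ∈ P.regularSet := fun z => (hx z).trans h

/-- By closedness of tangency only regular points matter. Near such a point all points are regular,
and fields tangent to `D` are images of one-forms under `π^♯`. -/
theorem isInvolutive_of_dense {D : ∀ x : M, Submodule ℝ (TSpace E M x)} (hD : IsDistribution D)
    (hdense : Dense P.regularSet) (h : ∀ x ∈ P.regularSet, D x = P.leafTangent x) :
    IsInvolutive D := by
  intro X Y hX hY x
  refine hD.mem_of_dense (W := lieBracket X Y) hdense (fun x hx => ?_) x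
  obtain ⟨α, U, θ, hF⟩ := P.exists_isDualFrame_rangeAt (x := x) (Eventually.of_forall hx)
  have key (Z : VecField E M) (hZ : ∀ y, Z y ∈ D y) :
      ∀ᶠ y in 𝓝 x, Z y = P.sharpHom (∑ i, pairing (θ i) Z • α i) y := by
    filter_upwards [hF.isOpen.mem_nhds hF.mem] with y hy
    have hyreg : y ∈ P.regularSet := P.regular_of_rank_le hx (hF.finrank_eq hy).ge
    rw [map_sum, section_sum_apply]
    simp_rw [map_smul]
    refine hF.expand y hy _ ?_
    rw [← leafTangent_eq, ← h y hyreg]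
    exact hZ y
  rw [h x hx, leafTangent_eq, lieBracket_congr (key X hX) (key Y hY)]
  exact P.lieBracket_sharpHom_mem _ _ x

theorem sharp_mem_of_dense {D : ∀ x : M, Submodule ℝ (TSpace E M x)} (hD : IsDistribution D)
    (hdense : Dense P.regularSet) (h : ∀ x ∈ P.regularSet, D x = P.leafTangent x) (x : M)
    (α : CoTSpace E M x) : P.sharp x α ∈ D x := by
  obtain ⟨β, hβ⟩ := exists_compactSection_apply_eq (E := E) (F := E →L[ℝ] ℝ)
    (V := CoTSpace E M) x α
  rw [← hβ]
  refine hD.mem_of_dense (W := P.sharpHom β) hdense (fun y hy => ?_) x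
  rw [h y hy, leafTangent_eq]
  exact P.sharp_mem_rangeAt _

end PoissonStructure

/-! ### From an isomorphism `𝓕 ≅ Γ_c(A)` to density and a distribution. -/

namespace PoissonStructure

variable {E : Type u} [NormedAddCommGroup E] [NormedSpace ℝ E]
  {M : Type v} [TopologicalSpace M] [ChartedSpace E M] [IsManifold 𝓘(ℝ, E) ∞ M]
  (P : PoissonStructure E M)

/-- The sharp map from compactly supported one-forms onto the foliation. -/
def sharpCompact : compactSections E (E →L[ℝ] ℝ) (CoTSpace E M) →ₗ[C^∞⟮𝓘(ℝ, E), M; ℝ⟯]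
    P.foliation :=
  (P.sharpHom ∘ₗ Submodule.subtype _).codRestrict P.foliation fun α => ⟨α, α.2, fun _ => rfl⟩

theorem sharpCompact_apply (α : compactSections E (E →L[ℝ] ℝ) (CoTSpace E M)) :
    (P.sharpCompact α : VecField E M) = P.sharpHom α := rfl

theorem sharpCompact_surjective : Function.Surjective P.sharpCompact := by
  rintro ⟨X, α, hα, hX⟩
  exact ⟨⟨α, hα⟩, Subtype.ext (ContMDiffSection.ext fun x => (hX x).symm)⟩

section Bundle

variable {P}
  {F : Type*} [NormedAddCommGroup F] [NormedSpace ℝ F]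
  {A : M → Type*} [TopologicalSpace (TotalSpace F A)]
  [∀ x, TopologicalSpace (A x)] [FiberBundle F A]
  [∀ x, AddCommGroup (A x)] [∀ x, Module ℝ (A x)] [VectorBundle ℝ F A]
  (Φ : P.foliation ≃ₗ[C^∞⟮𝓘(ℝ, E), M; ℝ⟯] compactSections E F A)

/-- The map `Γ_c(T^*M) → Γ(A)` induced by an isomorphism of the foliation with `Γ_c(A)`. -/
def toSections : compactSections E (E →L[ℝ] ℝ) (CoTSpace E M) →ₗ[C^∞⟮𝓘(ℝ, E), M; ℝ⟯]
    Cₛ^∞⟮𝓘(ℝ, E); F, A⟯ :=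
  Submodule.subtype _ ∘ₗ Φ.toLinearMap ∘ₗ P.sharpCompact

/-- The anchor map `Γ_c(A) → Γ(TM)`. -/
def anchor : compactSections E F A →ₗ[C^∞⟮𝓘(ℝ, E), M; ℝ⟯] VecField E M :=
  Submodule.subtype _ ∘ₗ Φ.symm.toLinearMap

theorem exists_toSections_eq (s : compactSections E F A) :
    ∃ α : compactSections E (E →L[ℝ] ℝ) (CoTSpace E M), Φ (P.sharpCompact α) = s := by
  obtain ⟨α, hα⟩ := P.sharpCompact_surjective (Φ.symm s)
  exact ⟨α, by rw [hα, LinearEquiv.apply_symm_apply]⟩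

variable [FiniteDimensional ℝ E] [T2Space M]

/-- The fibrewise factor `T_x^*M → A_x` of the sharp map. -/
abbrev fiberLift (x : M) : CoTSpace E M x →ₗ[ℝ] A x := fiberMap (toSections Φ) x

theorem fiberLift_apply (α : compactSections E (E →L[ℝ] ℝ) (CoTSpace E M)) (x : M) :
    fiberLift Φ x ((α : OneForm E M) x) =
      (Φ (P.sharpCompact α) : Cₛ^∞⟮𝓘(ℝ, E); F, A⟯) x :=
  fiberMap_apply (toSections Φ) α x

variable [FiniteDimensional ℝ F] [ContMDiffVectorBundle ∞ F A 𝓘(ℝ, E)]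

theorem fiberLift_surjective (x : M) : Function.Surjective (fiberLift Φ x) := by
  intro v
  obtain ⟨s, hs⟩ := exists_compactSection_apply_eq (E := E) (F := F) x v
  obtain ⟨α, hα⟩ := exists_toSections_eq Φ s
  exact ⟨(α : OneForm E M) x, by rw [fiberLift_apply, hα, hs]⟩

theorem fiberMap_anchor_fiberLift (x : M) (c : CoTSpace E M x) :
    fiberMap (anchor Φ) x (fiberLift Φ x c) = P.sharp x c := by
  obtain ⟨α, rfl⟩ := exists_compactSection_apply_eq (E := E) (F := E →L[ℝ] ℝ)
    (V := CoTSpace E M) x c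
  rw [fiberLift_apply, fiberMap_apply]
  change (Φ.symm (Φ (P.sharpCompact α)) : VecField E M) x = _
  rw [LinearEquiv.symm_apply_apply]
  rfl

theorem sharp_eq_zero_of_fiberLift {x : M} {c : CoTSpace E M x} (h : fiberLift Φ x c = 0) :
    P.sharp x c = 0 := by
  rw [← fiberMap_anchor_fiberLift Φ, h, map_zero]

omit [FiniteDimensional ℝ E] [T2Space M] [IsManifold 𝓘(ℝ, E) ∞ M] [FiniteDimensional ℝ F]
  [ContMDiffVectorBundle ∞ F A 𝓘(ℝ, E)] [ChartedSpace E M] in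
variable (F A) in
theorem finrank_fiber (x : M) : finrank ℝ (A x) = finrank ℝ F :=
  ((trivializationAt F A x).linearEquivAt ℝ x
    (FiberBundle.mem_baseSet_trivializationAt F A x)).finrank_eq

include Φ in
theorem rank_le (x : M) : P.rank x ≤ finrank ℝ F := by
  have := VectorBundle.finiteDimensional ℝ F A x
  rw [← finrank_fiber F A x]
  have h1 : P.rangeAt x ≤ LinearMap.range (fiberMap (anchor Φ) x) := by
    rintro _ ⟨c, rfl⟩
    exact ⟨fiberLift Φ x c, fiberMap_anchor_fiberLift Φ x c⟩
  have hfd : FiniteDimensional ℝ (TSpace E M x) := inferInstanceAs (FiniteDimensional ℝ E)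
  exact (Submodule.finrank_mono h1).trans (LinearMap.finrank_range_le _)

include Φ in
-- Since `fiberLift` is onto, a dimension count reduces the missing inequality to `ker π^♯ ⊆ ker
-- (fiberLift)` at `x`.
theorem rank_eq_of_locally_maximal {x : M} (hx : ∀ᶠ y in 𝓝 x, P.rank y ≤ P.rank x) :
    P.rank x = finrank ℝ F := by
  have := VectorBundle.finiteDimensional ℝ F A x
  refine le_antisymm (rank_le Φ x) ?_
  have hfd : FiniteDimensional ℝ (CoTSpace E M x) :=
    inferInstanceAs (FiniteDimensional ℝ (E →L[ℝ] ℝ))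
  suffices h : LinearMap.ker (P.sharp x : CoTSpace E M x →ₗ[ℝ] TSpace E M x) ≤
      LinearMap.ker (fiberLift Φ x) by
    have h1 := Submodule.finrank_mono h
    have h2 := LinearMap.finrank_range_add_finrank_ker
      (P.sharp x : CoTSpace E M x →ₗ[ℝ] TSpace E M x)
    have h3 := LinearMap.finrank_range_add_finrank_ker (fiberLift Φ x)
    rw [LinearMap.range_eq_top.2 (fiberLift_surjective Φ x), finrank_top, finrank_fiber F A x] at h3
    unfold PoissonStructure.rank
    omega
  intro a ha
  have ha' : P.sharp x a = 0 := ha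
  obtain ⟨α, U, θ, hF⟩ := P.exists_isDualFrame_rangeAt hx
  obtain ⟨c, hc⟩ := exists_compactSection_apply_eq (E := E) (F := E →L[ℝ] ℝ)
    (V := CoTSpace E M) x a
  -- The correction removes the image of `c` under `π^♯` throughout `U`, and vanishes at `x` because
  -- `π^♯ a = 0`: so `γ` extends `a` within `ker π^♯`.
  let γ : OneForm E M := c - ∑ i, pairing (θ i) (P.sharpHom c) • α i
  have hγ : ∀ y ∈ U, P.sharpHom γ y = 0 := by
    intro y hy
    rw [map_sub, map_sum, ContMDiffSection.coe_sub, Pi.sub_apply, section_sum_apply, sub_eq_zero]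
    simp_rw [map_smul]
    exact hF.expand y hy _ (P.sharp_mem_rangeAt _)
  have hγx : γ x = a := by
    change (c : OneForm E M) x - (∑ i, pairing (θ i) (P.sharpHom c) • α i : OneForm E M) x = a
    have h0 : ∀ i, pairing (θ i) (P.sharpHom c) x = 0 := fun i => by
      rw [pairing_apply, sharpHom_apply, hc, ha']
      exact map_zero _
    rw [section_sum_apply, hc]
    simp [h0]
  obtain ⟨χ, h1, hsupp, hχ⟩ := exists_bump (E := E) x (hF.isOpen.mem_nhds hF.mem)
  have hzero : P.sharpCompact ⟨χ • γ, section_smul_mem_compactSections hχ γ⟩ = 0 := by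
    refine Subtype.ext (ContMDiffSection.ext fun y => ?_)
    rw [sharpCompact_apply, map_smul, smul_section_apply]
    by_cases hy : y ∈ U
    · rw [hγ y hy, smul_zero]
      rfl
    · rw [image_eq_zero_of_notMem_tsupport fun h => hy (hsupp h), zero_smul]
      rfl
  have h2 := fiberLift_apply Φ ⟨χ • γ, section_smul_mem_compactSections hχ γ⟩ x
  rw [hzero, map_zero, smul_section_apply, h1.self_of_nhds, one_smul, hγx] at h2
  exact h2

include Φ in
theorem exists_rank_eq {U : Set M} (hU : IsOpen U) (hne : U.Nonempty) :
    ∃ x ∈ U, P.rank x = finrank ℝ F := by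
  -- Minimising the defect maximises the rank on `U`; `rank_le` ensures that the truncated
  -- subtraction loses nothing.
  obtain ⟨x, hx, hmin⟩ := (measure fun x => finrank ℝ F - P.rank x).wf.has_min U hne
  refine ⟨x, hx, rank_eq_of_locally_maximal Φ ?_⟩
  filter_upwards [hU.mem_nhds hx] with y hy
  have h1 : ¬ finrank ℝ F - P.rank y < finrank ℝ F - P.rank x := hmin y hy
  have h2 := rank_le Φ x
  have h3 := rank_le Φ y
  omega

include Φ in
theorem regularSet_dense : Dense P.regularSet := by
  refine dense_iff_inter_open.2 fun U hU hne => ?_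
  obtain ⟨x, hx, hr⟩ := exists_rank_eq Φ hU hne
  exact ⟨x, hx, fun y => hr ▸ rank_le Φ y⟩

include Φ in
theorem rank_eq_of_mem_regularSet {x : M} (hx : x ∈ P.regularSet) : P.rank x = finrank ℝ F :=
  rank_eq_of_locally_maximal Φ (Eventually.of_forall hx)

/-- The annihilator of the kernel of `T_x^*M → A_x`, i.e. the image of the dual map
`A_x^* → T_xM`. -/
def dualImage (x : M) : Submodule ℝ (TSpace E M x) where
  carrier := {v | ∀ c : CoTSpace E M x, fiberLift Φ x c = 0 → (c : TSpace E M x →L[ℝ] ℝ) v = 0}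
  zero_mem' _ _ := map_zero _
  add_mem' := by
    intro v w hv hw c hc
    rw [map_add, hv c hc, hw c hc, add_zero]
  smul_mem' := by
    intro a v hv c hc
    rw [map_smul, hv c hc, smul_zero]

theorem rangeAt_le_dualImage (x : M) : P.rangeAt x ≤ dualImage Φ x :=
  fun _ hv _ hc => P.apply_eq_zero_of_mem_rangeAt (sharp_eq_zero_of_fiberLift Φ hc) hv

/-- The frame is the image of the local dual frame of `A^*` under the transpose of `fiberLift`; the
dual one-forms are lifts of the frame of `A`. -/
theorem exists_isDualFrame_dualImage (x : M) : ∃ (U : Set M) (Y : Fin (finrank ℝ F) → VecField E M)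
    (θ : Fin (finrank ℝ F) → OneForm E M), IsDualFrame (dualImage Φ) x U Y θ := by
  obtain ⟨U₁, e, c, hU₁, hx₁, he, hv, hce, hc⟩ := exists_frame (E := E) F A x
  obtain ⟨U₂, X, f, hF⟩ := exists_coordinates (E := E) x
  choose α hα using fun i => exists_toSections_eq Φ ⟨e i, he i⟩
  -- `toSections` accepts only compactly supported forms, so the coordinate differentials are cut
  -- off.
  choose χ η hηc hη h0 h1 using fun l => exists_section_eventuallyEq (V := CoTSpace E M)
    hF.isOpen hF.mem (dForm (f l)).contMDiff.contMDiffOn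
  let s (l) : Cₛ^∞⟮𝓘(ℝ, E); F, A⟯ := toSections Φ ⟨η l, hηc l⟩
  choose g hg using fun i l => exists_contMDiffMap_eventuallyEq hU₁ hx₁ (hc (s l) i)
  have hev : ∀ᶠ y in 𝓝 x, y ∈ U₁ ∧ y ∈ U₂ ∧ (∀ l, χ l y = 1) ∧
      ∀ i l, g i l y = c i y (s l y) := by
    filter_upwards [hU₁.mem_nhds hx₁, hF.isOpen.mem_nhds hF.mem, eventually_all.2 h1,
      eventually_all.2 fun i => eventually_all.2 (hg i)] with y h1 h2 h3 h4
    exact ⟨h1, h2, h3, h4⟩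
  -- `IsDualFrame` asks for tangency at every point, while the formula for `Y'` is valid only near
  -- `x`; this second cutoff removes the rest.
  obtain ⟨χ', hχ1, hχsupp, -⟩ := exists_bump (E := E) x hev
  obtain ⟨W, hW, hWo, hxW⟩ := mem_nhds_iff.1 (hχ1.and hev)
  -- Near `x` the coefficient `g i l` is `c i` of the lift of `df_l`, so `Y' i` is the transpose of
  -- `fiberLift` applied to `c i`.
  let Y' (i) : VecField E M := ∑ l, g i l • X l
  have key : ∀ y, (y ∈ U₁ ∧ y ∈ U₂ ∧ (∀ l, χ l y = 1) ∧ ∀ i l, g i l y = c i y (s l y)) →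
      ∀ i (β : CoTSpace E M y), (β : TSpace E M y →L[ℝ] ℝ) (Y' i y) = c i y (fiberLift Φ y β) := by
    rintro y ⟨hy1, hy2, hy3, hy4⟩ i β
    conv_rhs => rw [hF.covector_eq_sum hy2 β]
    rw [section_sum_apply, map_sum, map_sum, map_sum]
    refine Finset.sum_congr rfl fun l _ => ?_
    rw [smul_section_apply, map_smul, map_smul, map_smul, hy4, smul_eq_mul, smul_eq_mul, mul_comm]
    congr 2
    have h5 := fiberMap_apply (toSections Φ) ⟨η l, hηc l⟩ y
    rw [← h5]
    congr 1
    change η l y = _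
    rw [hη, hy3, one_smul]
  have hYW : ∀ y ∈ W, ∀ i, (χ' • Y' i : VecField E M) y = Y' i y := fun y hy i => by
    rw [smul_section_apply, (hW hy).1, one_smul]
  have hTα : ∀ y i, fiberLift Φ y ((α i : OneForm E M) y) = e i y := fun y i => by
    rw [fiberLift_apply, hα]
  refine ⟨W, fun i => χ' • Y' i, fun i => α i, hWo, hxW, fun y hy i j => ?_, fun y i => ?_,
    fun y hy v hv' => ?_⟩
  · rw [pairing_apply, hYW y hy, key y (hW hy).2, hTα, hce y (hW hy).2.1]
    simp [eq_comm]
  · by_cases hy : y ∈ tsupport χ'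
    · rw [smul_section_apply]
      refine Submodule.smul_mem _ _ fun β hβ => ?_
      rw [key y (hχsupp hy), hβ, map_zero]
    · rw [smul_section_apply, image_eq_zero_of_notMem_tsupport hy, zero_smul]
      exact zero_mem _
  · rw [← sub_eq_zero]
    by_contra hne
    obtain ⟨β, hβ⟩ := exists_covector_ne_zero hne
    refine hβ ?_
    -- Subtracting lifts of the components of `fiberLift β` puts `β` in the kernel that `v`
    -- annihilates.
    have h2 := hv' (β - ∑ i, c i y (fiberLift Φ y β) • (α i : OneForm E M) y) (by
      rw [map_sub, map_sum]
      simp_rw [map_smul, hTα]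
      rw [sub_eq_zero]
      exact hv y (hW hy).2.1 _)
    rw [map_sub, map_sum]
    simp_rw [map_smul, hYW y hy, key y (hW hy).2]
    change (β : TSpace E M y →L[ℝ] ℝ) v -
      ((∑ i, c i y (fiberLift Φ y β) • (α i : OneForm E M) y : CoTSpace E M y) :
        TSpace E M y →L[ℝ] ℝ) v = 0 at h2
    rw [_root_.sum_apply] at h2
    rw [← h2]
    congr 1
    refine Finset.sum_congr rfl fun i _ => ?_
    exact mul_comm _ _

theorem isDistribution_dualImage : IsDistribution (dualImage Φ) :=
  .of_isDualFrame (exists_isDualFrame_dualImage Φ)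

/-- The image of `π^♯` lies in `dualImage` everywhere, and at regular points both have the rank of
`A`. -/
theorem dualImage_eq_leafTangent {x : M} (hx : x ∈ P.regularSet) :
    dualImage Φ x = P.leafTangent x := by
  have hfd : FiniteDimensional ℝ (TSpace E M x) := inferInstanceAs (FiniteDimensional ℝ E)
  obtain ⟨U, Y, θ, hF⟩ := exists_isDualFrame_dualImage Φ x
  rw [leafTangent_eq]
  refine (Submodule.eq_of_le_of_finrank_eq (rangeAt_le_dualImage Φ x) ?_).symm
  rw [hF.finrank_eq hF.mem]
  exact rank_eq_of_mem_regularSet Φ hx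

end Bundle

theorem AlmostRegular.dense_and_exists_isDistribution [FiniteDimensional ℝ E] [T2Space M]
    {P : PoissonStructure E M} (h : P.AlmostRegular) : Dense P.regularSet ∧
      ∃ D : ∀ x : M, Submodule ℝ (TSpace E M x),
        IsDistribution D ∧ ∀ x ∈ P.regularSet, D x = P.leafTangent x := by
  obtain ⟨r, A, _, _, _, _, _, _, _, ⟨Φ⟩⟩ := h
  exact ⟨regularSet_dense Φ, dualImage Φ, isDistribution_dualImage Φ,
    fun x hx => dualImage_eq_leafTangent Φ hx⟩

end PoissonStructure

/-! ### The dual bundle `D^*` and restriction of one-forms to `D`. -/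

section DualBundle

variable {E : Type u} [NormedAddCommGroup E] [NormedSpace ℝ E]
  {M : Type v} [TopologicalSpace M] [ChartedSpace E M] [IsManifold 𝓘(ℝ, E) ∞ M]
  {D : ∀ x : M, Submodule ℝ (TSpace E M x)} {k : ℕ} {U : M → Set M}
  {X : M → Fin k → VecField E M} {θ : M → Fin k → OneForm E M}

variable (X θ) in
/-- The transition maps of the dual of a distribution with local frames `X a` and dual
one-forms `θ a`. -/
def dualCoordChange (a b y : M) : (Fin k → ℝ) →L[ℝ] (Fin k → ℝ) :=
  ∑ j, ∑ i, pairing (θ a i) (X b j) y •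
    (ContinuousLinearMap.single ℝ (fun _ : Fin k => ℝ) j ∘L ContinuousLinearMap.proj i)

theorem dualCoordChange_apply (a b y : M) (v : Fin k → ℝ) (j : Fin k) :
    dualCoordChange X θ a b y v j = ∑ i, pairing (θ a i) (X b j) y * v i := by
  simp [dualCoordChange, _root_.sum_apply, Finset.sum_apply, Pi.single_apply, Finset.sum_ite_irrel]

theorem contMDiff_dualCoordChange (a b : M) :
    ContMDiff 𝓘(ℝ, E) 𝓘(ℝ, (Fin k → ℝ) →L[ℝ] (Fin k → ℝ)) ∞ (dualCoordChange X θ a b) := by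
  refine contMDiff_finsetSum fun j _ => contMDiff_finsetSum fun i _ => ?_
  exact (pairing (θ a i) (X b j)).contMDiff.smul contMDiff_const

/-- Covectors at a point transform by `dualCoordChange`. -/
theorem dualCoordChange_covector (hF : ∀ a, IsDualFrame D a (U a) (X a) (θ a)) {a b y : M}
    (hy : y ∈ U a) (c : CoTSpace E M y) (j : Fin k) :
    dualCoordChange X θ a b y (fun i => (c : TSpace E M y →L[ℝ] ℝ) (X a i y)) j =
      (c : TSpace E M y →L[ℝ] ℝ) (X b j y) := by
  rw [dualCoordChange_apply, (hF a).covector_apply hy c ((hF b).mem_D y j)]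
  exact Finset.sum_congr rfl fun i _ => mul_comm _ _

/-- The dual bundle of a distribution, given by local frames. -/
def dualCore (hF : ∀ a, IsDualFrame D a (U a) (X a) (θ a)) :
    VectorBundleCore ℝ M (Fin k → ℝ) M where
  baseSet := U
  isOpen_baseSet a := (hF a).isOpen
  -- Trivialisations are indexed by the points of `M`, so an element of the fibre over `y` lists the
  -- values of a covector on the frame `X y` centred at `y`.
  indexAt := id
  mem_baseSet_at a := (hF a).mem
  coordChange := dualCoordChange X θ
  coordChange_self a y hy v := by
    ext j
    rw [dualCoordChange_apply]
    simp_rw [(hF a).dual y hy]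
    simp
  continuousOn_coordChange a b := (contMDiff_dualCoordChange a b).continuous.continuousOn
  coordChange_comp a b c y hy v := by
    ext j
    -- Every coordinate vector `v` comes from the covector `∑ v_l θ_l`, so the cocycle rule reduces
    -- to the transformation law of covectors.
    have h1 : dualCoordChange X θ a b y v =
        fun i => (∑ l, v l • θ a l y : TSpace E M y →L[ℝ] ℝ) (X b i y) := by
      ext i
      rw [dualCoordChange_apply, _root_.sum_apply]
      exact Finset.sum_congr rfl fun l _ => mul_comm _ _
    rw [h1, dualCoordChange_covector hF hy.1.2, dualCoordChange_apply, _root_.sum_apply]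
    exact Finset.sum_congr rfl fun l _ => mul_comm _ _

instance isContMDiff_dualCore (hF : ∀ a, IsDualFrame D a (U a) (X a) (θ a)) :
    (dualCore hF).IsContMDiff 𝓘(ℝ, E) ∞ :=
  ⟨fun a b => (contMDiff_dualCoordChange a b).contMDiffOn⟩

/-- The restriction of a one-form to the distribution at a point. -/
def restrictAt (hF : ∀ a, IsDualFrame D a (U a) (X a) (θ a)) (α : OneForm E M) (y : M) :
    (dualCore hF).Fiber y := fun i => (α y : TSpace E M y →L[ℝ] ℝ) (X y i y)

/-- Restriction of one-forms to the distribution, as sections of the dual bundle. -/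
def restrictForm (hF : ∀ a, IsDualFrame D a (U a) (X a) (θ a)) (α : OneForm E M) :
    Cₛ^∞⟮𝓘(ℝ, E); Fin k → ℝ, (dualCore hF).Fiber⟯ where
  toFun := restrictAt hF α
  contMDiff_toFun x := by
    refine (contMDiffAt_section x).2 ?_
    have h1 : ContMDiffAt 𝓘(ℝ, E) 𝓘(ℝ, Fin k → ℝ) ∞ (fun y i => pairing α (X x i) y) x :=
      contMDiffAt_pi_space.2 fun i => (pairing α (X x i)).contMDiff x
    refine h1.congr_of_eventuallyEq (Eventually.of_forall fun y => ?_)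
    ext i
    exact dualCoordChange_covector hF (hF y).mem (α y) i

theorem restrictForm_apply_eq_zero_iff (hF : ∀ a, IsDualFrame D a (U a) (X a) (θ a))
    (α : OneForm E M) (y : M) : restrictForm hF α y = 0 ↔
      ∀ v ∈ D y, (α y : TSpace E M y →L[ℝ] ℝ) v = 0 := by
  refine ⟨fun h v hv => ?_, fun h => ?_⟩
  · rw [(hF y).covector_apply (hF y).mem _ hv]
    refine Finset.sum_eq_zero fun i _ => ?_
    rw [show (α y : TSpace E M y →L[ℝ] ℝ) (X y i y) = 0 from congrFun h i, zero_mul]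
  · refine funext fun i => ?_
    exact h _ ((hF y).mem_D y i)

/-- Restriction of compactly supported one-forms to the distribution. -/
def restrictCompact (hF : ∀ a, IsDualFrame D a (U a) (X a) (θ a)) :
    compactSections E (E →L[ℝ] ℝ) (CoTSpace E M) →ₗ[C^∞⟮𝓘(ℝ, E), M; ℝ⟯]
      compactSections E (Fin k → ℝ) (dualCore hF).Fiber where
  toFun α := ⟨restrictForm hF α, by
    refine α.2.of_isClosed_subset isClosed_closure (closure_mono fun y hy h => hy ?_)
    rw [restrictForm_apply_eq_zero_iff, h]
    exact fun _ _ => rfl⟩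
  map_add' α β := rfl
  map_smul' f α := rfl

variable [FiniteDimensional ℝ E] [T2Space M] [SecondCountableTopology M]

/-- Extending a section of `D^*` to a one-form that vanishes off a compact `K` imposes affine
conditions at each point, so a partition of unity glues local solutions. The support of the section
lies in the interior of `K`: points there use the coframe `θ x`, all others the zero form. -/
theorem restrictCompact_surjective (hF : ∀ a, IsDualFrame D a (U a) (X a) (θ a)) :
    Function.Surjective (restrictCompact hF) := by
  rintro ⟨s, hs⟩
  have : LocallyCompactSpace M := Manifold.locallyCompact_of_finiteDimensional 𝓘(ℝ, E)
  obtain ⟨K, hK, hsK⟩ := exists_compact_superset hs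
  obtain ⟨α, hα⟩ := exists_contMDiffSection_forall_mem_convex_of_local (n := ⊤) 𝓘(ℝ, E)
    (F_fiber := E →L[ℝ] ℝ) (CoTSpace E M)
    (fun y => {c | (∀ i, (c : TSpace E M y →L[ℝ] ℝ) (X y i y) = s y i) ∧ (y ∉ K → c = 0)})
    (fun y => by
      rintro c ⟨hc1, hc2⟩ d ⟨hd1, hd2⟩ p q hp hq hpq
      refine ⟨fun i => ?_, fun hy => by rw [hc2 hy, hd2 hy]; simp⟩
      change p * (c : TSpace E M y →L[ℝ] ℝ) (X y i y) + q * (d : TSpace E M y →L[ℝ] ℝ) (X y i y) = _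
      rw [hc1, hd1, ← add_mul, hpq, one_mul])
    (fun x => by
      by_cases hx : x ∈ interior K
      · let e := trivializationAt (Fin k → ℝ) (dualCore hF).Fiber x
        have hw := (e.contMDiffOn_section_baseSet_iff (IB := 𝓘(ℝ, E)) (n := ∞)).1
          s.contMDiff.contMDiffOn
        let w (y : M) : Fin k → ℝ := dualCoordChange X θ y x y (s y)
        have hw' : ContMDiffOn 𝓘(ℝ, E) 𝓘(ℝ, Fin k → ℝ) ∞ w (U x) := hw
        refine ⟨U x ∩ interior K, inter_mem ((hF x).isOpen.mem_nhds (hF x).mem)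
          (isOpen_interior.mem_nhds hx), fun y => ∑ i, w y i • θ x i y, ?_,
          fun y hy => ⟨fun j => ?_, fun hyK => (hyK (interior_subset hy.2)).elim⟩⟩
        · refine ContMDiffOn.mono ?_ inter_subset_left
          refine ContMDiffOn.sum_section fun i _ => ?_
          exact (contMDiffOn_pi_space.1 hw' i).smul_section (θ x i).contMDiff.contMDiffOn
        · rw [_root_.sum_apply]
          have h2 := congrFun (((dualCore hF).coordChange_comp y x y y
            ⟨⟨(hF y).mem, hy.1⟩, (hF y).mem⟩ (s y)).trans
            ((dualCore hF).coordChange_self y y (hF y).mem (s y))) j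
          change dualCoordChange X θ x y y (w y) j = _ at h2
          rw [← h2, dualCoordChange_apply]
          exact Finset.sum_congr rfl fun i _ => mul_comm _ _
      · refine ⟨(closure {y | s y ≠ 0})ᶜ, isClosed_closure.isOpen_compl.mem_nhds
          fun h => hx (hsK h), 0, (contMDiff_zeroSection ℝ (CoTSpace E M)).contMDiffOn,
          fun y hy => ⟨fun i => ?_, fun _ => rfl⟩⟩
        have h0 : s y = 0 := by
          by_contra h
          exact hy (subset_closure h)
        rw [h0]
        rfl)
  refine ⟨⟨α, ?_⟩, Subtype.ext (ContMDiffSection.ext fun y => funext fun i => (hα y).1 i)⟩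
  refine hK.of_isClosed_subset isClosed_closure (closure_minimal (fun y hy => ?_) hK.isClosed)
  by_contra h
  exact hy ((hα y).2 h)

end DualBundle

/-! ### From a distribution to almost regularity. -/

section

variable {E : Type u} [NormedAddCommGroup E] [NormedSpace ℝ E] [FiniteDimensional ℝ E]
  {M : Type v} [TopologicalSpace M] [ChartedSpace E M] [IsManifold 𝓘(ℝ, E) ∞ M] [T2Space M]

omit [FiniteDimensional ℝ E] [T2Space M] in
theorem pairing_eq_zero_of_dense {α : OneForm E M} {V : VecField E M} {S : Set M} (hS : Dense S)
    (h : ∀ y ∈ S, pairing α V y = 0) (x : M) : pairing α V x = 0 :=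
  congrFun ((pairing α V).contMDiff.continuous.ext_on hS continuous_const h) x

/-- If `π^♯ α = 0`, skew-symmetry makes `α` vanish on `im π^♯ = D` over `M_reg`, hence on `D`
everywhere by density. If `α` vanishes on `D ⊇ im π^♯`, skew-symmetry gives `π^♯ α = 0`. -/
theorem PoissonStructure.ker_sharpCompact_eq (P : PoissonStructure E M)
    {D : ∀ x : M, Submodule ℝ (TSpace E M x)} {k : ℕ} {U : M → Set M}
    {X : M → Fin k → VecField E M} {θ : M → Fin k → OneForm E M}
    (hF : ∀ a, IsDualFrame D a (U a) (X a) (θ a)) (hD : IsDistribution D)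
    (hdense : Dense P.regularSet) (h : ∀ x ∈ P.regularSet, D x = P.leafTangent x) :
    LinearMap.ker P.sharpCompact = LinearMap.ker (restrictCompact hF) := by
  ext α
  have h1 : α ∈ LinearMap.ker P.sharpCompact ↔ ∀ y, P.sharp y ((α : OneForm E M) y) = 0 := by
    rw [LinearMap.mem_ker, Subtype.ext_iff]
    exact ⟨fun h y => congrArg (fun V : VecField E M => V y) h, fun h => ContMDiffSection.ext h⟩
  have h2 : α ∈ LinearMap.ker (restrictCompact hF) ↔ ∀ y, ∀ v ∈ D y,
      ((α : OneForm E M) y : TSpace E M y →L[ℝ] ℝ) v = 0 := by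
    rw [LinearMap.mem_ker, Subtype.ext_iff]
    refine ⟨fun h y => (restrictForm_apply_eq_zero_iff hF _ y).1 ?_, fun h =>
      ContMDiffSection.ext fun y => (restrictForm_apply_eq_zero_iff hF _ y).2 (h y)⟩
    exact congrArg (fun V : Cₛ^∞⟮𝓘(ℝ, E); Fin k → ℝ, (dualCore hF).Fiber⟯ => V y) h
  rw [h1, h2]
  refine ⟨fun h3 y v hv => ?_, fun h3 y => P.sharp_eq_zero_of_forall ?_⟩
  · rw [(hF y).covector_apply (hF y).mem _ hv]
    refine Finset.sum_eq_zero fun i _ => ?_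
    rw [show ((α : OneForm E M) y : TSpace E M y →L[ℝ] ℝ) (X y i y) = 0 from
      pairing_eq_zero_of_dense hdense (fun z hz => ?_) y, zero_mul]
    refine P.apply_eq_zero_of_mem_rangeAt (h3 z) ?_
    rw [← P.leafTangent_eq, ← h z hz]
    exact (hF y).mem_D z i
  · rintro v ⟨c, rfl⟩
    exact h3 y _ (P.sharp_mem_of_dense hD hdense h y c)

/-- `𝓕` and `Γ_c(D^*)` are quotients of `Γ_c(T^*M)` by the same kernel. -/
theorem PoissonStructure.almostRegular_of_isDistribution [SecondCountableTopology M]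
    (P : PoissonStructure E M) {D : ∀ x : M, Submodule ℝ (TSpace E M x)} (hD : IsDistribution D)
    (hdense : Dense P.regularSet) (h : ∀ x ∈ P.regularSet, D x = P.leafTangent x) :
    P.AlmostRegular := by
  obtain ⟨k, hk⟩ := hD.exists_isDualFrame
  choose U X θ hF using hk
  refine ⟨k, (dualCore hF).Fiber, inferInstance, inferInstance, inferInstance, inferInstance,
    inferInstance, inferInstance, inferInstance, ⟨?_⟩⟩
  exact (P.sharpCompact.quotKerEquivOfSurjective P.sharpCompact_surjective).symm ≪≫ₗ
    Submodule.quotEquivOfEq _ _ (P.ker_sharpCompact_eq hF hD hdense h) ≪≫ₗ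
    (restrictCompact hF).quotKerEquivOfSurjective (restrictCompact_surjective hF)

end

/-! ### Induced Poisson structures on immersed submanifolds. -/

section Submanifold

variable {E : Type u} [NormedAddCommGroup E] [NormedSpace ℝ E] [FiniteDimensional ℝ E]
  {M : Type v} [TopologicalSpace M] [ChartedSpace E M] [IsManifold 𝓘(ℝ, E) ∞ M] [T2Space M]

/-- A field of maps `T^*M → TM` is smooth if its brackets of smooth functions are smooth. -/
theorem contMDiff_sharp_of_bracket (S : ∀ x : M, CoTSpace E M x →L[ℝ] TSpace E M x)
    (h : ∀ f g : C^∞⟮𝓘(ℝ, E), M; ℝ⟯, ContMDiff 𝓘(ℝ, E) 𝓘(ℝ, ℝ) ∞ (bracket S f g)) :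
    ContMDiff 𝓘(ℝ, E) (𝓘(ℝ, E).prod 𝓘(ℝ, (E →L[ℝ] ℝ) →L[ℝ] E)) ∞
      (fun x => TotalSpace.mk' ((E →L[ℝ] ℝ) →L[ℝ] E)
        (E := fun x : M => CoTSpace E M x →L[ℝ] TSpace E M x) x (S x)) := by
  refine contMDiff_hom_of_apply (F := E →L[ℝ] ℝ) (F' := E) (V := CoTSpace E M) (V' := TSpace E M)
    S fun β x => ?_
  obtain ⟨U, X, f, hF⟩ := exists_coordinates (E := E) x
  let b (i j) : C^∞⟮𝓘(ℝ, E), M; ℝ⟯ := ⟨bracket S (f i) (f j), h _ _⟩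
  refine ((∑ i, ∑ j, (pairing β (X i) * b i j) • X j : VecField E M).contMDiff
    x).congr_of_eventuallyEq ?_
  filter_upwards [hF.isOpen.mem_nhds hF.mem] with y hy
  congr 1
  conv_lhs => rw [hF.covector_eq_sum hy (β y)]
  rw [map_sum, section_sum_apply]
  refine Finset.sum_congr rfl fun i _ => ?_
  rw [map_smul, section_sum_apply]
  conv_lhs => rw [hF.expand y hy (S y (dForm (f i) y)) trivial]
  rw [Finset.smul_sum]
  refine Finset.sum_congr rfl fun j _ => ?_
  rw [smul_smul]
  rfl

variable {G : Type*} [NormedAddCommGroup G] [NormedSpace ℝ G]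
  {N : Type w} [TopologicalSpace N] [ChartedSpace G N] [IsManifold 𝓘(ℝ, G) ∞ N] {ι : N → M}

omit [IsManifold 𝓘(ℝ, G) ∞ N] in
/-- Smooth functions extend locally along an immersion. -/
theorem exists_extension {y : N} (h : Manifold.IsImmersionAt 𝓘(ℝ, G) 𝓘(ℝ, E) ∞ ι y)
    (f : C^∞⟮𝓘(ℝ, G), N; ℝ⟯) :
    ∃ g : C^∞⟮𝓘(ℝ, E), M; ℝ⟯, ∀ᶠ z in 𝓝 y, f z = g (ι z) := by
  let φ := h.domChart
  let ψ := h.codChart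
  let e := h.equiv
  -- In the immersion charts `ι` reads `u ↦ e (u, 0)`, so projecting to the first factor recovers
  -- the chart coordinate on `N`: `φ.symm ∘ p` is a local left inverse of `ι`.
  let p : M → G := fun z => (e.symm (ψ z)).1
  have hp : ContMDiffOn 𝓘(ℝ, E) 𝓘(ℝ, G) ∞ p ψ.source :=
    ((ContinuousLinearMap.fst ℝ G h.complement).comp
      (e.symm : E →L[ℝ] G × h.complement)).contMDiff.comp_contMDiffOn
      (contMDiffOn_of_mem_maximalAtlas h.codChart_mem_maximalAtlas)
  let W : Set M := ψ.source ∩ p ⁻¹' φ.target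
  have hW : IsOpen W := hp.continuousOn.isOpen_inter_preimage ψ.open_source φ.open_target
  have hpι : ∀ z ∈ φ.source, p (ι z) = φ z := by
    intro z hz
    have hmem : φ z ∈ (h.domChart.extend 𝓘(ℝ, G)).target := by simpa using φ.map_source hz
    have h1 := h.writtenInCharts hmem
    have h2 : ψ (ι z) = e (φ z, 0) := by simpa [φ.left_inv hz, φ, ψ, e] using h1
    change (e.symm (ψ (ι z))).1 = _
    rw [h2, ContinuousLinearEquiv.symm_apply_apply]
  have hιW : ∀ z ∈ φ.source, ι z ∈ W := fun z hz =>
    ⟨h.source_subset_preimage_source hz, by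
      rw [mem_preimage, hpι z hz]
      exact φ.map_source hz⟩
  have hsm : ContMDiffOn 𝓘(ℝ, E) 𝓘(ℝ, ℝ) ∞ (f ∘ φ.symm ∘ p) W :=
    f.contMDiff.comp_contMDiffOn ((contMDiffOn_symm_of_mem_maximalAtlas
      h.domChart_mem_maximalAtlas).comp (hp.mono inter_subset_left) inter_subset_right)
  obtain ⟨g, hg⟩ := exists_contMDiffMap_eventuallyEq hW (hιW y h.mem_domChart_source) hsm
  refine ⟨g, ?_⟩
  filter_upwards [h.continuousAt.eventually hg, φ.open_source.mem_nhds h.mem_domChart_source]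
    with z hz hzφ
  rw [hz]
  simp [hpι z hzφ, φ.left_inv hzφ]

omit [FiniteDimensional ℝ E] [IsManifold 𝓘(ℝ, E) ∞ M] [T2Space M] [IsManifold 𝓘(ℝ, G) ∞ N] in
theorem differential_of_eventuallyEq_comp (hι : ContMDiff 𝓘(ℝ, G) 𝓘(ℝ, E) ∞ ι) {y : N}
    {f : N → ℝ} {g : C^∞⟮𝓘(ℝ, E), M; ℝ⟯} (h : ∀ᶠ z in 𝓝 y, f z = g (ι z)) :
    (differential f y : CoTSpace G N y) =
      (show TSpace E M (ι y) →L[ℝ] ℝ from differential g (ι y)).comp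
        (mfderiv 𝓘(ℝ, G) 𝓘(ℝ, E) ι y : TSpace G N y →L[ℝ] TSpace E M (ι y)) := by
  rw [differential_congr h]
  exact mfderiv_comp y (g.contMDiff.mdifferentiable (by simp) (ι y))
    (hι.mdifferentiable (by simp) y)

variable [FiniteDimensional ℝ G] [T2Space N]

/-- Functions on `N` extend locally to `M`, so every covector on `N` factors through `dι` and
vanishes on its kernel. -/
theorem mfderiv_injective_of_isImmersion (hι : Manifold.IsImmersion 𝓘(ℝ, G) 𝓘(ℝ, E) ∞ ι) (y : N) :
    Function.Injective (mfderiv 𝓘(ℝ, G) 𝓘(ℝ, E) ι y : TSpace G N y →L[ℝ] TSpace E M (ι y)) := by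
  refine (injective_iff_map_eq_zero _).2 fun v hv => ?_
  by_contra hne
  obtain ⟨c, hc⟩ := exists_covector_ne_zero hne
  obtain ⟨f, rfl⟩ := exists_differential_eq y c
  obtain ⟨g, hg⟩ := exists_extension (hι.isImmersionAt y) f
  rw [differential_of_eventuallyEq_comp hι.contMDiff hg] at hc
  exact hc ((congrArg (differential g (ι y) : TSpace E M (ι y) →L[ℝ] ℝ) hv).trans (map_zero _))

variable {P : PoissonStructure E M}

/-- The pointwise data of a Poisson structure on an immersed submanifold. -/
theorem exists_inducedSharp (hι : Manifold.IsImmersion 𝓘(ℝ, G) 𝓘(ℝ, E) ∞ ι)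
    (hP : ∀ (y : N) (α : CoTSpace E M (ι y)), P.sharp (ι y) α ∈ LinearMap.range
      (mfderiv 𝓘(ℝ, G) 𝓘(ℝ, E) ι y : TSpace G N y →ₗ[ℝ] TSpace E M (ι y))) (y : N) :
    ∃ S : CoTSpace G N y →L[ℝ] TSpace G N y, (∀ α β : CoTSpace G N y, β (S α) = -α (S β)) ∧
      ∀ α : CoTSpace E M (ι y), mfderiv 𝓘(ℝ, G) 𝓘(ℝ, E) ι y
        (S (ContinuousLinearMap.comp (show TSpace E M (ι y) →L[ℝ] ℝ from α)
          (mfderiv 𝓘(ℝ, G) 𝓘(ℝ, E) ι y : TSpace G N y →L[ℝ] TSpace E M (ι y)))) =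
      P.sharp (ι y) α := by
  have : FiniteDimensional ℝ (TSpace E M (ι y)) := inferInstanceAs (FiniteDimensional ℝ E)
  have : T2Space (TSpace E M (ι y)) := inferInstanceAs (T2Space E)
  let d : TSpace G N y →L[ℝ] TSpace E M (ι y) := mfderiv 𝓘(ℝ, G) 𝓘(ℝ, E) ι y
  obtain ⟨L', hL'⟩ := LinearMap.exists_leftInverse_of_injective d.toLinearMap
    (LinearMap.ker_eq_bot.2 (mfderiv_injective_of_isImmersion hι y))
  let L : TSpace E M (ι y) →L[ℝ] TSpace G N y := LinearMap.toContinuousLinearMap L'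
  have hL : ∀ v, L (d v) = v := fun v => congrArg (fun g => g v) hL'
  let L₀ : E →L[ℝ] G := L
  let T₀ : (G →L[ℝ] ℝ) →L[ℝ] E →L[ℝ] ℝ := (ContinuousLinearMap.compL ℝ E G ℝ).flip L₀
  let T : CoTSpace G N y →L[ℝ] CoTSpace E M (ι y) := T₀
  -- `L` is a left inverse of `dι` and `T` its transpose; conjugating `π^♯` by this pair keeps it
  -- skew.
  refine ⟨L ∘L P.sharp (ι y) ∘L T, fun α β => P.skew (ι y) (T α) (T β), fun α => ?_⟩
  let α' : CoTSpace E M (ι y) := T (ContinuousLinearMap.comp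
    (show TSpace E M (ι y) →L[ℝ] ℝ from α) d)
  -- `α' = α ∘ dι ∘ L` agrees with `α` on the range of `dι`, hence on `im π^♯`, and `π^♯` depends
  -- only on that restriction.
  have h1 : P.sharp (ι y) α' = P.sharp (ι y) α := by
    rw [← sub_eq_zero, ← map_sub]
    refine P.sharp_eq_zero_of_forall ?_
    rintro _ ⟨c, rfl⟩
    obtain ⟨w, hw⟩ := hP y c
    change (α : TSpace E M (ι y) →L[ℝ] ℝ) (d (L (P.sharp (ι y) c))) -
      (α : TSpace E M (ι y) →L[ℝ] ℝ) (P.sharp (ι y) c) = 0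
    rw [← show d w = P.sharp (ι y) c from hw, hL, sub_self]
  change d (L (P.sharp (ι y) α')) = _
  rw [h1]
  obtain ⟨w, hw⟩ := hP y α
  rw [← show d w = P.sharp (ι y) α from hw, hL]

/-- Near a point of `N`, the bracket of two functions is the pullback of the bracket of their
extensions to `M`. Smoothness and the Jacobi identity are therefore inherited from `M`. -/
theorem isPoissonSubmanifold_of_sharp_mem_range (hinj : Function.Injective ι)
    (hι : Manifold.IsImmersion 𝓘(ℝ, G) 𝓘(ℝ, E) ∞ ι)
    (hP : ∀ (y : N) (α : CoTSpace E M (ι y)), P.sharp (ι y) α ∈ LinearMap.range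
      (mfderiv 𝓘(ℝ, G) 𝓘(ℝ, E) ι y : TSpace G N y →ₗ[ℝ] TSpace E M (ι y))) :
    IsPoissonSubmanifold (G := G) P ι := by
  choose S hskew hS using exists_inducedSharp hι hP
  have hbr {y : N} {f₁ f₂ : N → ℝ} {g₁ g₂ : C^∞⟮𝓘(ℝ, E), M; ℝ⟯}
      (h₁ : ∀ᶠ z in 𝓝 y, f₁ z = g₁ (ι z)) (h₂ : ∀ᶠ z in 𝓝 y, f₂ z = g₂ (ι z)) :
      bracket S f₁ f₂ y = pairing (dForm g₂) (P.sharpHom (dForm g₁)) (ι y) := by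
    unfold bracket
    rw [differential_of_eventuallyEq_comp hι.contMDiff h₁,
      differential_of_eventuallyEq_comp hι.contMDiff h₂]
    exact congrArg (differential g₂ (ι y) : TSpace E M (ι y) →L[ℝ] ℝ) (hS y (differential g₁ (ι y)))
  have hbr' {y : N} {f₁ f₂ : N → ℝ} {g₁ g₂ : C^∞⟮𝓘(ℝ, E), M; ℝ⟯}
      (h₁ : ∀ᶠ z in 𝓝 y, f₁ z = g₁ (ι z)) (h₂ : ∀ᶠ z in 𝓝 y, f₂ z = g₂ (ι z)) :
      ∀ᶠ z in 𝓝 y, bracket S f₁ f₂ z = pairing (dForm g₂) (P.sharpHom (dForm g₁)) (ι z) := by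
    filter_upwards [eventually_eventually_nhds.2 h₁, eventually_eventually_nhds.2 h₂] with z hz₁ hz₂
    exact hbr hz₁ hz₂
  refine ⟨hinj, hι, ⟨S, contMDiff_sharp_of_bracket S fun f g y => ?_, hskew, fun f g h y => ?_⟩, hS⟩
  · obtain ⟨f', hf⟩ := exists_extension (hι.isImmersionAt y) f
    obtain ⟨g', hg⟩ := exists_extension (hι.isImmersionAt y) g
    exact ((pairing (dForm g') (P.sharpHom (dForm f'))).contMDiff.comp
      hι.contMDiff y).congr_of_eventuallyEq (hbr' hf hg)
  · obtain ⟨f', hf⟩ := exists_extension (hι.isImmersionAt y) f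
    obtain ⟨g', hg⟩ := exists_extension (hι.isImmersionAt y) g
    obtain ⟨h', hh⟩ := exists_extension (hι.isImmersionAt y) h
    rw [hbr hf (hbr' hg hh), hbr hg (hbr' hh hf), hbr hh (hbr' hf hg)]
    exact P.jacobi f' g' h' (ι y)

end Submanifold

end AlmostRegularPoisson

end

theorem theorem2p6 {E : Type u} [NormedAddCommGroup E] [NormedSpace ℝ E] [FiniteDimensional ℝ E]
    {M : Type v} [TopologicalSpace M] [ChartedSpace E M] [IsManifold 𝓘(ℝ, E) ∞ M]
    [T2Space M] [SecondCountableTopology M] (P : PoissonStructure E M) :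
    (P.AlmostRegular ↔
      Dense P.regularSet ∧
        ∃ D : ∀ x : M, Submodule ℝ (TSpace E M x),
          IsDistribution D ∧ ∀ x ∈ P.regularSet, D x = P.leafTangent x) ∧
    (P.AlmostRegular →
      (∃! D : ∀ x : M, Submodule ℝ (TSpace E M x),
        IsDistribution D ∧ ∀ x ∈ P.regularSet, D x = P.leafTangent x) ∧
      ∀ D : ∀ x : M, Submodule ℝ (TSpace E M x),
        IsDistribution D → (∀ x ∈ P.regularSet, D x = P.leafTangent x) →
          IsInvolutive D ∧
          (∀ (x : M) (α : CoTSpace E M x), P.sharp x α ∈ D x) ∧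
          ∀ (k : ℕ) (N : Type w) [TopologicalSpace N] [ChartedSpace (EuclideanSpace ℝ (Fin k)) N]
            [IsManifold 𝓘(ℝ, EuclideanSpace ℝ (Fin k)) ∞ N] [T2Space N]
            [SecondCountableTopology N] (ι : N → M),
            IsIntegralManifold (G := EuclideanSpace ℝ (Fin k)) D ι →
              IsPoissonSubmanifold (G := EuclideanSpace ℝ (Fin k)) P ι) := by
  refine ⟨⟨fun h => h.dense_and_exists_isDistribution, fun ⟨hd, D, hD, h⟩ =>
    P.almostRegular_of_isDistribution hD hd h⟩, fun hP => ?_⟩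
  obtain ⟨hd, D, hD, h⟩ := hP.dense_and_exists_isDistribution
  refine ⟨⟨D, ⟨hD, h⟩, fun D' ⟨hD', h'⟩ => funext fun x => le_antisymm ?_ ?_⟩,
    fun D' hD' h' => ⟨P.isInvolutive_of_dense hD' hd h', P.sharp_mem_of_dense hD' hd h',
      fun k N _ _ _ _ _ ι hι => ?_⟩⟩
  · exact hD'.le_of_dense hD hd (fun y hy => ((h' y hy).trans (h y hy).symm).le) x
  · exact hD.le_of_dense hD' hd (fun y hy => ((h y hy).trans (h' y hy).symm).le) x
  · refine isPoissonSubmanifold_of_sharp_mem_range hι.injective hι.isImmersion fun y α => ?_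
    rw [hι.range_mfderiv y]
    exact P.sharp_mem_of_dense hD' hd h' _ α
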